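/- **Setting.** Let $H_1,H_2\in(0,1)$, $\sigma_1,\sigma_2>0$, $|\rho|\le 1$, let $W_1,W_2$ be independent standard Brownian motions on the real line, and put $\tilde W_1=W_1$, $\tilde W_2=\rho W_1+\sqrt{1-\rho^2}\,W_2$. With $x_+^\beta=x^\beta$ for $x>0$ and $x_+^\beta=0$ for $x\le0$, $x_-^\beta=(-x)_+^\beta$, let $f_\pm(s;t,\beta)=(t-s)_\pm^{\beta}-(-s)_\pm^{\beta}$. Two-dimensional fractional Brownian motion $\mathbf Z=(Z_1,Z_2)$ is defined by the Wiener integrals $$Z_j(t)=\sigma_j c_{j}\int_{\mathbb R}K_j(s;t)\,d\tilde W_j(s),\qquad t\ge0,\ j=1,2,$$ where * in the *causal* case, $K_j(s;t)=f_+(s;t,H_j-\tfrac12)$ and $c_j=\sqrt{\Gamma(2H_j+1)\sin(\pi H_j)}\,/\,\Gamma(H_j+\tfrac12)$; * in the *well-balanced* case, $K_j(s;t)=f_+(s;t,H_j-\tfrac12)+f_-(s;t,H_j-\tfrac12)$ if $H_j\ne\frac12$. For $H_j=\frac12$ this function vanishes for almost every $s$, and one takes $K_j(s;t)=\log|t-s|-\log|s|$,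 the limit of $(f_+(s;t,\beta)+f_-(s;t,\beta))/\beta$ as $\beta\to0$. Whether or not $H_j=\frac12$, in the well-balanced case $c_j=\left(\int_{\mathbb R}K_j(s;1)^2\,ds\right)^{-1/2}$, i.e. $c_j>0$ is such that $\langle Z_j(1)^2\rangle=\sigma_j^2$. Put $A=\sqrt{\Gamma(2H_1+1)\Gamma(2H_2+1)\sin(\pi H_1)\sin(\pi H_2)}$ and define $\rho_{11}=\rho_{22}=1$, $\eta_{11}=\eta_{22}=0$, $\rho_{21}=\rho_{12}$, $\eta_{21}=-\eta_{12}$, where * causal case: $$\rho_{12}=\rho\,\frac{A\,\cos\frac{(H_2-H_1)\pi}{2}}{\Gamma(H_1+H_2+1)\sin\frac{(H_1+H_2)\pi}{2}},\qquad \eta_{12}=\begin{cases}-\rho\,\dfrac{A\,\sin\frac{(H_2-H_1)\pi}{2}}{\Gamma(H_1+H_2+1)\cos\frac{(H_1+H_2)\pi}{2}},&H_1+H_2\ne1,\\[2ex] \dfrac{2}{\pi}\,\rho\,A\,\sin\frac{(H_2-H_1)\pi}{2},&H_1+H_2=1;\end{cases}$$ * well-balanced case: $$\rho_{12}=\epsilon_1\epsilon_2\,\rho\,\frac{A}{\Gamma(H_1+H_2+1)\sin\frac{(H_1+H_2)\pi}{2}},\qquad\eta_{12}=0,$$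 with $\epsilon_j=-1$ if $H_j<\frac12$ and $\epsilon_j=1$ if $H_j\ge\frac12$. Finally, let $w_{jk}(u)=\rho_{jk}-\eta_{jk}\,\mathrm{sign}(u)$ if $H_j+H_k\ne1$ and $w_{jk}(u)=\rho_{jk}-\eta_{jk}\,\mathrm{sign}(u)\log|u|$ if $H_j+H_k=1$; the product $w_{jk}(u)|u|^{H_j+H_k}$ is $0$ at $u=0$. **Theorem.** In both cases, for all $\delta>0$, $t,s\ge0$ and $j,k\in\{1,2\}$, the increments $\Delta^\delta Z_j(t)=Z_j(t+\delta)-Z_j(t)$ satisfy: $\Delta^\delta Z_j(t)\,\Delta^\delta Z_k(s)$ is integrable and $$\langle\Delta^\delta Z_j(t)\,\Delta^\delta Z_k(s)\rangle=\frac{\sigma_j\sigma_k}{2}\Big[w_{jk}(t-s+\delta)\,|t-s+\delta|^{H_j+H_k}+w_{jk}(t-s-\delta)\,|t-s-\delta|^{H_j+H_k}-2\,w_{jk}(t-s)\,|t-s|^{H_j+H_k}\Big].$$ In particular, the cross-covariance of the increments depends on $t$ and $s$ only through $t-s$. -/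

import Mathlib

open MeasureTheory ProbabilityTheory Filter Topology
open scoped NNReal ENNReal

noncomputable section

namespace FBm2D

/-! ### Brownian motion on the real line and Wiener integrals -/

/-- A standard Brownian motion indexed by the whole real line: its restrictions to the positive
and to the (reflected) negative half-line are independent standard Brownian motions, with almost
surely continuous paths. -/
structure IsTwoSidedBrownian {Ω : Type*} [MeasurableSpace Ω] (B : ℝ → Ω → ℝ) (P : Measure Ω) :
    Prop where
  pos : IsBrownianReal (fun (t : ℝ≥0) ω => B (t : ℝ) ω) P
  neg : IsBrownianReal (fun (t : ℝ≥0) ω => B (-(t : ℝ)) ω) P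
  indep : IndepFun (fun ω (t : ℝ≥0) => B (t : ℝ) ω) (fun ω (t : ℝ≥0) => B (-(t : ℝ)) ω) P

/-- Data of a step function `∑ i, coeff i * 1_{(left i, right i]}` on the real line. -/
structure StepFunction where
  n : ℕ
  coeff : Fin n → ℝ
  left : Fin n → ℝ
  right : Fin n → ℝ
  left_le_right : ∀ i, left i ≤ right i

/-- The function on the real line described by the data. -/
def StepFunction.toFun (φ : StepFunction) (x : ℝ) : ℝ :=
  ∑ i, (Set.Ioc (φ.left i) (φ.right i)).indicator (fun _ => φ.coeff i) x

/-- The integral of a step function against the increments of `B`. -/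
def StepFunction.integral {Ω : Type*} (φ : StepFunction) (B : ℝ → Ω → ℝ) (ω : Ω) : ℝ :=
  ∑ i, φ.coeff i * (B (φ.right i) ω - B (φ.left i) ω)

/-- `I` is (a version of) the Wiener integral `∫ f dB`: it is the limit in `L²(P)` of the integrals
of step functions that converge to `f` in `L²(ℝ)`. -/
def IsWienerIntegral {Ω : Type*} [MeasurableSpace Ω] (P : Measure Ω) (B : ℝ → Ω → ℝ)
    (f : ℝ → ℝ) (I : Ω → ℝ) : Prop :=
  MemLp I 2 P ∧ ∃ φ : ℕ → StepFunction,
    Tendsto (fun n => eLpNorm (fun x => f x - (φ n).toFun x) 2 volume) atTop (𝓝 0) ∧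
    Tendsto (fun n => eLpNorm (fun ω => I ω - (φ n).integral B ω) 2 P) atTop (𝓝 0)

open Classical in
/-- The Wiener integral `∫ f dB` (a chosen version; `0` if there is none). -/
def wienerIntegral {Ω : Type*} [MeasurableSpace Ω] (P : Measure Ω) (B : ℝ → Ω → ℝ)
    (f : ℝ → ℝ) : Ω → ℝ :=
  if h : ∃ I, IsWienerIntegral P B f I then h.choose else 0

/-! ### Kernels -/

/-- `(x)_+ ^ β`, equal to `0` for `x ≤ 0` also when `β ≤ 0`. -/
def posPow (x β : ℝ) : ℝ := if 0 < x then x ^ β else 0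

/-- `f_+(x; t, β) = (t - x)_+ ^ β - (-x)_+ ^ β`. -/
def fPlus (x t β : ℝ) : ℝ := posPow (t - x) β - posPow (-x) β

/-- `f_-(x; t, β) = (t - x)_- ^ β - (-x)_- ^ β`, where `(x)_- = (-x)_+`. -/
def fMinus (x t β : ℝ) : ℝ := posPow (-(t - x)) β - posPow (- -x) β

/-- The two constructions of the process. -/
inductive Model where
  | causal
  | wellBalanced

/-- The kernel `s ↦ K(s; t)` before normalization. For `H = 1/2` the function `f_+ + f_-` vanishes
almost everywhere; the well-balanced kernel is then the limit of
`(f_+(s; t, β) + f_-(s; t, β)) / β` as `β → 0`. -/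
def kernel (model : Model) (H t s : ℝ) : ℝ :=
  match model with
  | .causal => fPlus s t (H - 1 / 2)
  | .wellBalanced =>
      if H = 1 / 2 then Real.log |t - s| - Real.log |s|
      else fPlus s t (H - 1 / 2) + fMinus s t (H - 1 / 2)

/-- The nonnegative normalizing constant. In the causal case it is given explicitly; in the
well-balanced case it is the one for which the normalized kernel of time `1` has norm `1`
in `L²(ℝ)`. -/
def normConst (model : Model) (H : ℝ) : ℝ :=
  match model with
  | .causal => √(Real.Gamma (2 * H + 1) * Real.sin (H * Real.pi)) / Real.Gamma (H + 1 / 2)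
  | .wellBalanced => 1 / √(∫ s, kernel .wellBalanced H 1 s ^ 2)

/-! ### The process -/

/-- The matrix that turns independent noises into `ρ`-correlated ones. -/
def noiseMatrix (ρ : ℝ) : Matrix (Fin 2) (Fin 2) ℝ := !![1, 0; ρ, √(1 - ρ ^ 2)]

/-- The matrix-valued kernel of two-dimensional fractional Brownian motion. -/
def matrixKernel (model : Model) (H σ : Fin 2 → ℝ) (ρ t s : ℝ) : Matrix (Fin 2) (Fin 2) ℝ :=
  Matrix.diagonal (fun j => σ j * normConst model (H j) * kernel model (H j) t s) * noiseMatrix ρ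

/-- Two-dimensional fractional Brownian motion: `Z(t) = ∫ (matrixKernel t s) dW(s)`. -/
def process {Ω : Type*} [MeasurableSpace Ω] (P : Measure Ω) (W : Fin 2 → ℝ → Ω → ℝ)
    (model : Model) (H σ : Fin 2 → ℝ) (ρ t : ℝ) (ω : Ω) (j : Fin 2) : ℝ :=
  ∑ m, wienerIntegral P (W m) (fun s => matrixKernel model H σ ρ t s j m) ω

/-- The increment `Z(t + δ) - Z(t)`. -/
def increment {Ω : Type*} (Z : ℝ → Ω → Fin 2 → ℝ) (δ t : ℝ) (ω : Ω) : Fin 2 → ℝ :=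
  Z (t + δ) ω - Z t ω

/-! ### The parameters of the covariance -/

/-- `√(Γ(2H₁+1) Γ(2H₂+1) sin(H₁π) sin(H₂π))`. -/
def amplitude (H : Fin 2 → ℝ) : ℝ :=
  √(Real.Gamma (2 * H 0 + 1) * Real.Gamma (2 * H 1 + 1) *
    Real.sin (H 0 * Real.pi) * Real.sin (H 1 * Real.pi))

/-- The sign of the transfer function of the well-balanced kernel with positive normalization. -/
def balanceSign (H : ℝ) : ℝ := if H < 1 / 2 then -1 else 1

/-- The cross-correlation parameters `ρ_jk`. -/
def rhoCoeff (model : Model) (H : Fin 2 → ℝ) (ρ : ℝ) (j k : Fin 2) : ℝ :=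
  if j = k then 1
  else
    match model with
    | .causal =>
        ρ * (amplitude H /
          (Real.Gamma (H 0 + H 1 + 1) * Real.sin ((H 0 + H 1) / 2 * Real.pi))) *
          Real.cos ((H 1 - H 0) * Real.pi / 2)
    | .wellBalanced =>
        balanceSign (H 0) * balanceSign (H 1) * ρ * (amplitude H /
          (Real.Gamma (H 0 + H 1 + 1) * Real.sin ((H 0 + H 1) / 2 * Real.pi)))

/-- The asymmetry parameter `η_12`. -/
def etaOneTwo (model : Model) (H : Fin 2 → ℝ) (ρ : ℝ) : ℝ :=
  match model with
  | .causal =>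
      if H 0 + H 1 = 1 then
        2 / Real.pi * ρ * amplitude H * Real.sin ((H 1 - H 0) * Real.pi / 2)
      else
        -(ρ * (amplitude H /
          (Real.Gamma (H 0 + H 1 + 1) * Real.cos ((H 0 + H 1) / 2 * Real.pi))) *
          Real.sin ((H 1 - H 0) * Real.pi / 2))
  | .wellBalanced => 0

/-- The asymmetry parameters `η_jk`: `η_11 = η_22 = 0` and `η_21 = -η_12`. -/
def etaCoeff (model : Model) (H : Fin 2 → ℝ) (ρ : ℝ) : Matrix (Fin 2) (Fin 2) ℝ :=
  !![0, etaOneTwo model H ρ; -etaOneTwo model H ρ, 0]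

/-- The function `w_jk`. -/
def w (model : Model) (H : Fin 2 → ℝ) (ρ : ℝ) (j k : Fin 2) (u : ℝ) : ℝ :=
  if H j + H k = 1 then
    rhoCoeff model H ρ j k - etaCoeff model H ρ j k * Real.sign u * Real.log |u|
  else
    rhoCoeff model H ρ j k - etaCoeff model H ρ j k * Real.sign u

end FBm2D

end

namespace FBm2D

/-! The Wiener isometry turns expectations of products into `L²(ℝ)` pairings of kernels, and
independent noises are orthogonal (`IsWienerIntegral.integral_mul`,
`IsWienerIntegral.integral_mul_of_indepFun`). Each kernel is a multiple of `g (t - x) - g (-x)`, so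
its pairing with another is a mixed second difference of one function `V` (`HasCross`). Such a
difference does not see affine terms of `V`, and this freedom is used throughout.

Let `a = H₁ - 1/2`, `b = H₂ - 1/2`. For one-sided powers with `a + b < 0`, subtracting `(-x)_+ ^ (a
+ b)` makes each of the four products integrable; a Beta integral and the reflection formula
evaluate them (`integral_posPow_mul_posPow_sub`). For `a + b > 0`, a power with positive exponent is
written as an integral of powers with exponent lowered by one (`hasCross_posPow_of_add_pos`). As `a
+ b → 0` the coefficients have a pole, but its singular part is linear in `u`. Removing it by a
linear term gives a continuous family whose value at `a + b = 0` contains `u * log |u|`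
(`causalCross_eq`, `hasCross_posPow`): this is the logarithm in `w`.

The well-balanced kernel adds the reflected power. Opposite one-sided powers pair through an
ordinary Beta integral, and the four pairings sum to a multiple of `|u| ^ (a + b + 1)`, so no
asymmetric term survives. The normalized family `boxCox` passes continuously through the logarithm,
and limits in the exponents cover every case (`hasCross_boxCox`). The same formula evaluates the
normalizing integral; its square root forgets the sign of `H - 1/2`, which leaves the factors
`balanceSign`. -/

lemma integrable_mul_of_memLp_two {α : Type*} [MeasurableSpace α] {μ : Measure α} {f g : α → ℝ}
    (hf : MemLp f 2 μ) (hg : MemLp g 2 μ) : Integrable (fun x => f x * g x) μ :=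
  hf.integrable_mul hg

/-! ### Second moments of Brownian increments -/

namespace IsTwoSidedBrownian

variable {Ω : Type*} [MeasurableSpace Ω] {B : ℝ → Ω → ℝ} {P : Measure Ω}

lemma memLp (hB : IsTwoSidedBrownian B P) (x : ℝ) : MemLp (B x) 2 P := by
  rcases le_total 0 x with hx | hx
  · have := (hB.pos.isGaussianProcess.hasGaussianLaw_eval x.toNNReal).memLp_two
    simpa [Real.coe_toNNReal _ hx] using this
  · have := (hB.neg.isGaussianProcess.hasGaussianLaw_eval (-x).toNNReal).memLp_two
    simpa [Real.coe_toNNReal _ (neg_nonneg.2 hx)] using this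

lemma integral_eq_zero (hB : IsTwoSidedBrownian B P) (x : ℝ) : ∫ ω, B x ω ∂P = 0 := by
  rcases le_total 0 x with hx | hx
  · have := hB.pos.integral_eval x.toNNReal
    simpa [Real.coe_toNNReal _ hx] using this
  · have := hB.neg.integral_eval (-x).toNNReal
    simpa [Real.coe_toNNReal _ (neg_nonneg.2 hx)] using this

lemma integral_mul_of_nonneg_of_nonpos [IsProbabilityMeasure P] (hB : IsTwoSidedBrownian B P)
    {x y : ℝ} (hx : 0 ≤ x) (hy : y ≤ 0) : ∫ ω, B x ω * B y ω ∂P = 0 := by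
  have h : IndepFun (fun ω => B (x.toNNReal : ℝ) ω) (fun ω => B (-((-y).toNNReal : ℝ)) ω) P :=
    hB.indep.comp (φ := fun f : ℝ≥0 → ℝ => f x.toNNReal)
      (ψ := fun f : ℝ≥0 → ℝ => f (-y).toNNReal) (by fun_prop) (by fun_prop)
  rw [Real.coe_toNNReal _ hx, Real.coe_toNNReal _ (neg_nonneg.2 hy), neg_neg] at h
  have := h.integral_mul_eq_mul_integral (hB.memLp x).1 (hB.memLp y).1
  simpa [hB.integral_eq_zero] using this

/-- The expression is the minimum of `|x|` and `|y|` when the points lie on the same side of the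
origin and `0` otherwise, so it joins the two half-lines in one formula. -/
lemma integral_mul [IsProbabilityMeasure P] (hB : IsTwoSidedBrownian B P) (x y : ℝ) :
    ∫ ω, B x ω * B y ω ∂P = (|x| + |y| - |x - y|) / 2 := by
  have key : ∀ (X : ℝ≥0 → Ω → ℝ), IsBrownianReal X P → ∀ s t : ℝ≥0,
      ∫ ω, X s ω * X t ω ∂P = min (s : ℝ) t := by
    intro X hX s t
    have h := hX.covariance_eval s t
    rw [covariance_eq_sub (hX.isGaussianProcess.hasGaussianLaw_eval s).memLp_two
      (hX.isGaussianProcess.hasGaussianLaw_eval t).memLp_two, hX.integral_eval,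
      hX.integral_eval] at h
    simpa using h
  rcases le_total 0 x with hx | hx <;> rcases le_total 0 y with hy | hy
  · have h := key _ hB.pos x.toNNReal y.toNNReal
    simp only [Real.coe_toNNReal _ hx, Real.coe_toNNReal _ hy] at h
    rw [h, abs_of_nonneg hx, abs_of_nonneg hy]
    rcases min_cases x y with h1 | h1 <;> rcases abs_cases (x - y) with h2 | h2 <;> linarith
  · rw [hB.integral_mul_of_nonneg_of_nonpos hx hy, abs_of_nonneg hx, abs_of_nonpos hy,
      abs_of_nonneg (by linarith)]
    ring
  · simp_rw [mul_comm (B x _)]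
    rw [hB.integral_mul_of_nonneg_of_nonpos hy hx, abs_of_nonneg hy, abs_of_nonpos hx,
      abs_of_nonpos (by linarith)]
    ring
  · have h := key _ hB.neg (-x).toNNReal (-y).toNNReal
    simp only [Real.coe_toNNReal _ (neg_nonneg.2 hx), Real.coe_toNNReal _ (neg_nonneg.2 hy),
      neg_neg] at h
    rw [h, abs_of_nonpos hx, abs_of_nonpos hy]
    rcases min_cases (-x) (-y) with h1 | h1 <;> rcases abs_cases (x - y) with h2 | h2 <;> linarith

lemma integral_sub_mul_sub [IsProbabilityMeasure P] (hB : IsTwoSidedBrownian B P)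
    (a b c d : ℝ) : ∫ ω, (B b ω - B a ω) * (B d ω - B c ω) ∂P =
      (|a - d| + |b - c| - |b - d| - |a - c|) / 2 := by
  have hi : ∀ x y, Integrable (fun ω => B x ω * B y ω) P := fun x y =>
    integrable_mul_of_memLp_two (hB.memLp x) (hB.memLp y)
  have : ∀ ω, (B b ω - B a ω) * (B d ω - B c ω) =
      (B b ω * B d ω - B b ω * B c ω) - (B a ω * B d ω - B a ω * B c ω) := fun ω => by ring
  simp_rw [this]
  have hs : ∀ x y z, Integrable (fun ω => B x ω * B y ω - B x ω * B z ω) P := fun x y z =>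
    (hi x y).sub (hi x z)
  rw [integral_sub (hs _ _ _) (hs _ _ _),
    integral_sub (hi _ _) (hi _ _), integral_sub (hi _ _) (hi _ _)]
  simp_rw [hB.integral_mul]
  ring

end IsTwoSidedBrownian

/-- The length of the overlap is put in the same form as the covariance of two Brownian increments;
comparing the two gives the isometry on step functions. -/
lemma integral_indicator_Ioc_mul_indicator_Ioc {a b c d : ℝ} (hab : a ≤ b) (hcd : c ≤ d)
    (p q : ℝ) :
    ∫ x, (Set.Ioc a b).indicator (fun _ => p) x * (Set.Ioc c d).indicator (fun _ => q) x =
      p * q * ((|a - d| + |b - c| - |b - d| - |a - c|) / 2) := by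
  have : ∀ x, (Set.Ioc a b).indicator (fun _ => p) x * (Set.Ioc c d).indicator (fun _ => q) x =
      (Set.Ioc (a ⊔ c) (b ⊓ d)).indicator (fun _ => p * q) x := by
    intro x
    rw [← Set.Ioc_inter_Ioc, Set.inter_indicator_mul]
  simp_rw [this]
  rw [integral_indicator measurableSet_Ioc, setIntegral_const, Real.volume_real_Ioc, smul_eq_mul,
    mul_comm]
  congr 1
  rcases abs_cases (a - d) with h1 | h1 <;> rcases abs_cases (b - c) with h2 | h2 <;>
  rcases abs_cases (b - d) with h3 | h3 <;> rcases abs_cases (a - c) with h4 | h4 <;>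
  rcases max_cases a c with h5 | h5 <;> rcases min_cases b d with h6 | h6 <;>
  rcases max_cases (b ⊓ d - (a ⊔ c)) 0 with h7 | h7 <;> linarith

/-! ### Step functions -/

namespace StepFunction

variable {Ω : Type*} [MeasurableSpace Ω] {B : ℝ → Ω → ℝ} {P : Measure Ω}

lemma memLp_toFun (φ : StepFunction) : MemLp φ.toFun 2 volume := by
  unfold toFun
  refine memLp_finsetSum _ fun i _ => memLp_indicator_const 2 measurableSet_Ioc _ (Or.inr ?_)
  simp

lemma memLp_integral (hB : IsTwoSidedBrownian B P) (φ : StepFunction) :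
    MemLp (φ.integral B) 2 P := by
  unfold integral
  exact memLp_finsetSum _ fun i _ => ((hB.memLp _).sub (hB.memLp _)).const_mul _

lemma integral_integral_mul_integral [IsProbabilityMeasure P] (hB : IsTwoSidedBrownian B P)
    (φ ψ : StepFunction) :
    ∫ ω, φ.integral B ω * ψ.integral B ω ∂P = ∫ x, φ.toFun x * ψ.toFun x := by
  have hi : ∀ x y, MemLp (fun ω => B x ω - B y ω) 2 P := fun x y => (hB.memLp x).sub (hB.memLp y)
  have hj : ∀ a b c : ℝ, MemLp ((Set.Ioc a b).indicator (fun _ => c)) 2 volume := fun a b c =>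
    memLp_indicator_const 2 measurableSet_Ioc _ (Or.inr (by simp))
  simp only [integral, toFun, Finset.sum_mul_sum]
  rw [integral_finsetSum _ fun i _ => integrable_finsetSum _ fun j _ =>
      integrable_mul_of_memLp_two ((hi _ _).const_mul _) ((hi _ _).const_mul _),
    integral_finsetSum _ fun i _ => integrable_finsetSum _ fun j _ =>
      integrable_mul_of_memLp_two (hj _ _ _) (hj _ _ _)]
  refine Finset.sum_congr rfl fun i _ => ?_
  rw [integral_finsetSum _ fun j _ =>
      integrable_mul_of_memLp_two ((hi _ _).const_mul _) ((hi _ _).const_mul _),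
    integral_finsetSum _ fun j _ => integrable_mul_of_memLp_two (hj _ _ _) (hj _ _ _)]
  refine Finset.sum_congr rfl fun j _ => ?_
  rw [integral_indicator_Ioc_mul_indicator_Ioc (φ.left_le_right i) (ψ.left_le_right j),
    ← hB.integral_sub_mul_sub, ← integral_const_mul]
  congr 1 with ω
  ring

lemma integral_integral_mul_integral_of_indepFun [IsProbabilityMeasure P] {B' : ℝ → Ω → ℝ}
    (hB : IsTwoSidedBrownian B P) (hB' : IsTwoSidedBrownian B' P)
    (h : IndepFun (fun ω (x : ℝ) => B x ω) (fun ω (x : ℝ) => B' x ω) P) (φ ψ : StepFunction) :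
    ∫ ω, φ.integral B ω * ψ.integral B' ω ∂P = 0 := by
  have hm : ∀ φ : StepFunction, Measurable
      (fun f : ℝ → ℝ => ∑ i, φ.coeff i * (f (φ.right i) - f (φ.left i))) := fun φ => by fun_prop
  have hφ : ∫ ω, φ.integral B ω ∂P = 0 := by
    unfold integral
    have hi : ∀ x, Integrable (B x) P := fun x => (hB.memLp x).integrable (by norm_num)
    have hs : ∀ x y, Integrable (fun ω => B x ω - B y ω) P := fun x y => (hi x).sub (hi y)
    rw [integral_finsetSum _ fun i _ => (hs _ _).const_mul _]
    refine Finset.sum_eq_zero fun i _ => ?_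
    rw [integral_const_mul, integral_sub (hi _) (hi _), hB.integral_eq_zero, hB.integral_eq_zero]
    simp
  have h2 : IndepFun (φ.integral B) (ψ.integral B') P := h.comp (hm φ) (hm ψ)
  have := h2.integral_mul_eq_mul_integral (φ.memLp_integral hB).1 (ψ.memLp_integral hB').1
  rw [hφ, zero_mul] at this
  exact this

end StepFunction

/-! ### Limits of second moments -/

/-- This is continuity of the inner product of `L²`. It extends both the isometry and the
orthogonality of independent noises from step functions to their limits. -/
lemma tendsto_integral_mul_of_tendsto_eLpNorm {α : Type*} [MeasurableSpace α] {μ : Measure α}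
    {f g : α → ℝ} {F G : ℕ → α → ℝ} (hf : MemLp f 2 μ) (hg : MemLp g 2 μ)
    (hF : ∀ n, MemLp (F n) 2 μ) (hG : ∀ n, MemLp (G n) 2 μ)
    (hfF : Tendsto (fun n => eLpNorm (fun x => f x - F n x) 2 μ) atTop (𝓝 0))
    (hgG : Tendsto (fun n => eLpNorm (fun x => g x - G n x) 2 μ) atTop (𝓝 0)) :
    Tendsto (fun n => ∫ x, F n x * G n x ∂μ) atTop (𝓝 (∫ x, f x * g x ∂μ)) := by
  have inner_toLp : ∀ {u v : α → ℝ} (hu : MemLp u 2 μ) (hv : MemLp v 2 μ),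
      inner ℝ (hu.toLp u) (hv.toLp v) = ∫ x, u x * v x ∂μ := by
    intro u v hu hv
    rw [L2.inner_def]
    refine integral_congr_ae ?_
    filter_upwards [hu.coeFn_toLp, hv.coeFn_toLp] with x h1 h2
    rw [h1, h2]
    simp [mul_comm]
  have hF' := (Lp.tendsto_Lp_iff_tendsto_eLpNorm'' F hF f hf).2 (by
    refine hfF.congr fun n => ?_
    rw [← eLpNorm_neg]; congr 1; ext x; simp)
  have hG' := (Lp.tendsto_Lp_iff_tendsto_eLpNorm'' G hG g hg).2 (by
    refine hgG.congr fun n => ?_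
    rw [← eLpNorm_neg]; congr 1; ext x; simp)
  have := hF'.inner (𝕜 := ℝ) hG'
  simpa only [inner_toLp] using this

namespace IsWienerIntegral

variable {Ω : Type*} [MeasurableSpace Ω] {P : Measure Ω} [IsProbabilityMeasure P]
  {B B' : ℝ → Ω → ℝ} {f g : ℝ → ℝ} {I J : Ω → ℝ}

lemma integral_mul (hB : IsTwoSidedBrownian B P) (hf : MemLp f 2 volume) (hg : MemLp g 2 volume)
    (hI : IsWienerIntegral P B f I) (hJ : IsWienerIntegral P B g J) :
    ∫ ω, I ω * J ω ∂P = ∫ x, f x * g x := by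
  obtain ⟨hI, φ, hφ, hφI⟩ := hI
  obtain ⟨hJ, ψ, hψ, hψJ⟩ := hJ
  have h1 := tendsto_integral_mul_of_tendsto_eLpNorm hf hg (fun n => (φ n).memLp_toFun)
    (fun n => (ψ n).memLp_toFun) hφ hψ
  have h2 := tendsto_integral_mul_of_tendsto_eLpNorm hI hJ (fun n => (φ n).memLp_integral hB)
    (fun n => (ψ n).memLp_integral hB) hφI hψJ
  simp_rw [StepFunction.integral_integral_mul_integral hB] at h2
  exact tendsto_nhds_unique h2 h1

lemma integral_mul_of_indepFun (hB : IsTwoSidedBrownian B P) (hB' : IsTwoSidedBrownian B' P)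
    (h : IndepFun (fun ω (x : ℝ) => B x ω) (fun ω (x : ℝ) => B' x ω) P)
    (hI : IsWienerIntegral P B f I) (hJ : IsWienerIntegral P B' g J) :
    ∫ ω, I ω * J ω ∂P = 0 := by
  obtain ⟨hI, φ, hφ, hφI⟩ := hI
  obtain ⟨hJ, ψ, hψ, hψJ⟩ := hJ
  have h2 := tendsto_integral_mul_of_tendsto_eLpNorm hI hJ (fun n => (φ n).memLp_integral hB)
    (fun n => (ψ n).memLp_integral hB') hφI hψJ
  simp_rw [StepFunction.integral_integral_mul_integral_of_indepFun hB hB' h] at h2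
  exact tendsto_nhds_unique h2 tendsto_const_nhds

end IsWienerIntegral

/-! ### Existence of Wiener integrals -/

lemma eLpNorm_two_eq_ofReal {α : Type*} [MeasurableSpace α] {μ : Measure α} {f : α → ℝ}
    (hf : MemLp f 2 μ) : eLpNorm f 2 μ = ENNReal.ofReal (√(∫ x, f x * f x ∂μ)) := by
  rw [hf.eLpNorm_eq_integral_rpow_norm (by norm_num) (by norm_num), Real.sqrt_eq_rpow]
  simp [← pow_two]

/-- Expanding the square lets the isometry for products yield the isometry for distances. -/
lemma integral_sub_mul_self {α : Type*} [MeasurableSpace α] {μ : Measure α} {u v : α → ℝ}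
    (hu : MemLp u 2 μ) (hv : MemLp v 2 μ) : ∫ x, (u - v) x * (u - v) x ∂μ =
      (∫ x, u x * u x ∂μ) - (∫ x, u x * v x ∂μ) - ((∫ x, v x * u x ∂μ) - ∫ x, v x * v x ∂μ) := by
  have huu := integrable_mul_of_memLp_two hu hu
  have huv := integrable_mul_of_memLp_two hu hv
  have hvu := integrable_mul_of_memLp_two hv hu
  have hvv := integrable_mul_of_memLp_two hv hv
  rw [← integral_sub huu huv, ← integral_sub hvu hvv]
  refine (integral_congr_ae (ae_of_all _ fun x => ?_)).trans
    (integral_sub (huu.sub huv) (hvu.sub hvv))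
  simp
  ring

/-! ### Distances between step functions, and their density in `L²(ℝ)` -/

namespace StepFunction

variable {Ω : Type*} [MeasurableSpace Ω] {B : ℝ → Ω → ℝ} {P : Measure Ω}

lemma eLpNorm_integral_sub [IsProbabilityMeasure P] (hB : IsTwoSidedBrownian B P)
    (φ ψ : StepFunction) : eLpNorm (φ.integral B - ψ.integral B) 2 P =
      eLpNorm (φ.toFun - ψ.toFun) 2 volume := by
  rw [eLpNorm_two_eq_ofReal ((φ.memLp_integral hB).sub (ψ.memLp_integral hB)),
    eLpNorm_two_eq_ofReal (φ.memLp_toFun.sub ψ.memLp_toFun)]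
  congr 2
  rw [integral_sub_mul_self (φ.memLp_integral hB) (ψ.memLp_integral hB),
    integral_sub_mul_self φ.memLp_toFun ψ.memLp_toFun]
  simp only [integral_integral_mul_integral hB]

/-- The step function with the values of `g` at the right end points of a grid of mesh `1 / n`. -/
noncomputable def ofGrid (g : ℝ → ℝ) (M n : ℕ) : StepFunction where
  n := 2 * M * n
  coeff i := g (-M + (i + 1) / n)
  left i := -M + i / n
  right i := -M + (i + 1) / n
  left_le_right i := by gcongr; linarith

lemma ofGrid_toFun_eq_zero (g : ℝ → ℝ) {M n : ℕ} (hn : 0 < n) {x : ℝ}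
    (hx : x ∉ Set.Ioc (-M : ℝ) M) : (ofGrid g M n).toFun x = 0 := by
  have hn' : (0 : ℝ) < n := by exact_mod_cast hn
  refine Finset.sum_eq_zero fun i _ => Set.indicator_of_notMem (fun h => hx ⟨?_, ?_⟩) _
  · have : (0 : ℝ) ≤ (i : ℕ) / n := by positivity
    have := h.1
    simp only [ofGrid] at this
    linarith
  · refine h.2.trans ?_
    simp only [ofGrid]
    have hi : ((i : ℕ) : ℝ) + 1 ≤ 2 * M * n := by exact_mod_cast i.2
    rw [← sub_nonneg]
    have : ((i : ℕ) + 1 : ℝ) / n ≤ 2 * M := by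
      rw [div_le_iff₀ hn']; exact hi
    linarith

lemma exists_ofGrid_toFun_eq (g : ℝ → ℝ) {M n : ℕ} (hn : 0 < n) {x : ℝ}
    (hx : x ∈ Set.Ioc (-M : ℝ) M) :
    ∃ y, |x - y| ≤ 1 / n ∧ (ofGrid g M n).toFun x = g y := by
  have hn' : (0 : ℝ) < n := by exact_mod_cast hn
  set k := ⌈(x + M) * n⌉₊ with hk
  have hpos : 0 < (x + M) * n := mul_pos (by linarith [hx.1]) hn'
  have hk0 : 0 < k := Nat.ceil_pos.2 hpos
  have hk1 : (k : ℝ) < (x + M) * n + 1 := Nat.ceil_lt_add_one hpos.le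
  have hk2 : (x + M) * n ≤ k := Nat.le_ceil _
  have hkM : k ≤ 2 * M * n := by
    refine Nat.ceil_le.2 ?_
    push_cast
    have := hx.2
    gcongr
    linarith
  -- The cells are half-open on the left, so the ceiling `k` numbers the right end point of the cell
  -- containing `x`; the cell itself has index `k - 1`.
  obtain ⟨i, hki⟩ : ∃ i, k = i + 1 := ⟨k - 1, by omega⟩
  rw [hki] at hk1 hk2 hkM
  push_cast at hk1 hk2
  refine ⟨-M + (i + 1) / n, ?_, ?_⟩
  · have h1 : x + M ≤ (i + 1) / n := by rwa [le_div_iff₀ hn']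
    have h2 : (i + 1) / n < x + M + 1 / n := by
      rw [div_lt_iff₀ hn', add_mul, div_mul_cancel₀ _ hn'.ne']
      linarith
    rw [abs_le]
    constructor <;> linarith
  · unfold toFun
    have hi : i < (ofGrid g M n).n := hkM
    rw [Finset.sum_eq_single ⟨i, hi⟩]
    · rw [Set.indicator_of_mem]
      · rfl
      · simp only [ofGrid]
        constructor
        · have : (i : ℝ) / n < x + M := by rw [div_lt_iff₀ hn']; linarith
          linarith
        · have h1 : x + M ≤ (i + 1) / n := by rwa [le_div_iff₀ hn']
          linarith
    · intro j _ hj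
      refine Set.indicator_of_notMem (fun h => hj ?_) _
      simp only [ofGrid] at h
      have h1 : ((j : ℕ) : ℝ) / n < x + M := by linarith [h.1]
      have h2 : x + M ≤ ((j : ℕ) + 1) / n := by linarith [h.2]
      rw [div_lt_iff₀ hn'] at h1
      rw [le_div_iff₀ hn'] at h2
      have h3 : ((j : ℕ) : ℝ) < i + 1 := by linarith
      have h4 : (i : ℝ) < (j : ℕ) + 1 := by linarith
      have h5 : (j : ℕ) < i + 1 := by exact_mod_cast h3
      have h6 : i < (j : ℕ) + 1 := by exact_mod_cast h4
      exact Fin.ext (by simp; omega)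
    · simp

/-- By uniform continuity a fine grid gives a uniform error `η` on an interval containing the
support, and the `L²` error is at most `η` times the square root of its length. -/
lemma exists_eLpNorm_sub_le_of_continuous {g : ℝ → ℝ} (hg : Continuous g)
    (hs : HasCompactSupport g) {ε : ℝ≥0∞} (hε : ε ≠ 0) :
    ∃ φ : StepFunction, eLpNorm (g - φ.toFun) 2 volume ≤ ε := by
  obtain ⟨R, hR⟩ := hs.isCompact.isBounded.subset_closedBall 0
  obtain ⟨M, hM⟩ := exists_nat_gt R
  have hout : ∀ x, x ∉ Set.Ioc (-M : ℝ) M → g x = 0 := by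
    intro x hx
    by_contra h
    have := hR (subset_closure h)
    rw [Metric.mem_closedBall, dist_zero_right, Real.norm_eq_abs, abs_le] at this
    exact hx ⟨by linarith, by linarith⟩
  set V : ℝ≥0∞ := volume (Set.Ioc (-M : ℝ) M) ^ (2 : ℝ≥0∞).toReal⁻¹ with hV
  have hVtop : V ≠ ∞ := by
    rw [hV, Real.volume_Ioc]
    exact ENNReal.rpow_ne_top_of_nonneg (by positivity) ENNReal.ofReal_ne_top
  obtain ⟨η, hη, hVη⟩ : ∃ η : ℝ, 0 < η ∧ V * ENNReal.ofReal η ≤ ε := by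
    rcases eq_or_ne ε ∞ with rfl | hεt
    · exact ⟨1, one_pos, le_top⟩
    -- The summand `1` avoids division by zero when the interval is empty.
    refine ⟨ε.toReal / (V.toReal + 1), ?_, ?_⟩
    · have := ENNReal.toReal_pos hε hεt
      positivity
    · have hV0 : 0 ≤ V.toReal := ENNReal.toReal_nonneg
      rw [← ENNReal.ofReal_toReal hVtop, ← ENNReal.ofReal_mul hV0]
      refine ENNReal.ofReal_le_of_le_toReal ?_
      rw [ENNReal.toReal_ofReal hV0, ← mul_div_assoc, div_le_iff₀ (by positivity)]
      nlinarith [ENNReal.toReal_nonneg (a := ε)]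
  obtain ⟨δ, hδ, hgδ⟩ := Metric.uniformContinuous_iff.1
    (hg.uniformContinuous_of_tendsto_cocompact hs.is_zero_at_infty) η hη
  obtain ⟨n, hn⟩ := exists_nat_one_div_lt hδ
  refine ⟨ofGrid g M (n + 1), le_trans ?_ hVη⟩
  have hind : g - (ofGrid g M (n + 1)).toFun =
      (Set.Ioc (-M : ℝ) M).indicator (g - (ofGrid g M (n + 1)).toFun) := by
    ext x
    by_cases hx : x ∈ Set.Ioc (-M : ℝ) M
    · rw [Set.indicator_of_mem hx]
    · rw [Set.indicator_of_notMem hx, Pi.sub_apply, hout x hx,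
        ofGrid_toFun_eq_zero g n.succ_pos hx, sub_zero]
  rw [hind, eLpNorm_indicator_eq_eLpNorm_restrict measurableSet_Ioc]
  refine (eLpNorm_le_of_ae_bound (C := η) ?_).trans ?_
  · refine ae_restrict_of_forall_mem measurableSet_Ioc fun x hx => ?_
    obtain ⟨y, hxy, hy⟩ := exists_ofGrid_toFun_eq g n.succ_pos hx
    rw [Pi.sub_apply, hy, ← dist_eq_norm]
    refine (hgδ ?_).le
    rw [Real.dist_eq]
    push_cast at hxy
    exact hxy.trans_lt hn
  · rw [Measure.restrict_apply MeasurableSet.univ, Set.univ_inter]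

lemma exists_eLpNorm_sub_le {f : ℝ → ℝ} (hf : MemLp f 2 volume) {ε : ℝ≥0∞} (hε : ε ≠ 0) :
    ∃ φ : StepFunction, eLpNorm (f - φ.toFun) 2 volume ≤ ε := by
  have hε2 : ε / 2 ≠ 0 := by simpa using hε
  obtain ⟨g, hs, hfg, hg, hgL⟩ := hf.exists_hasCompactSupport_eLpNorm_sub_le (by norm_num) hε2
  obtain ⟨φ, hφ⟩ := exists_eLpNorm_sub_le_of_continuous hg hs hε2
  refine ⟨φ, ?_⟩
  calc eLpNorm (f - φ.toFun) 2 volume = eLpNorm ((f - g) + (g - φ.toFun)) 2 volume := by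
        rw [sub_add_sub_cancel]
    _ ≤ eLpNorm (f - g) 2 volume + eLpNorm (g - φ.toFun) 2 volume :=
        eLpNorm_add_le (hf.1.sub hgL.1) (hgL.1.sub φ.memLp_toFun.1) (by norm_num)
    _ ≤ ε / 2 + ε / 2 := add_le_add hfg hφ
    _ = ε := ENNReal.add_halves ε

end StepFunction

section Existence

variable {Ω : Type*} [MeasurableSpace Ω] {P : Measure Ω} [IsProbabilityMeasure P]
  {B : ℝ → Ω → ℝ} {f : ℝ → ℝ}

/-- Step functions converging to `f` are Cauchy; by the isometry so are their integrals, and `L²(P)`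
is complete. -/
lemma exists_isWienerIntegral (hB : IsTwoSidedBrownian B P) (hf : MemLp f 2 volume) :
    ∃ I, IsWienerIntegral P B f I := by
  have hpos : ∀ n : ℕ, ((2 : ℝ≥0∞)⁻¹ ^ n) ≠ 0 := fun n => by simp
  choose φ hφ using fun n : ℕ => StepFunction.exists_eLpNorm_sub_le hf (hpos n)
  have hφ0 : Tendsto (fun n => eLpNorm (f - (φ n).toFun) 2 volume) atTop (𝓝 0) :=
    tendsto_of_tendsto_of_tendsto_of_le_of_le tendsto_const_nhds
      (ENNReal.tendsto_pow_atTop_nhds_zero_of_lt_one (by norm_num)) (fun _ => zero_le) hφ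
  have htoFun := (Lp.tendsto_Lp_iff_tendsto_eLpNorm'' (fun n => (φ n).toFun)
    (fun n => (φ n).memLp_toFun) f hf).2 (by
      refine hφ0.congr fun n => ?_
      rw [← eLpNorm_neg, neg_sub])
  have hcauchy : CauchySeq fun n => ((φ n).memLp_integral hB).toLp := by
    have := htoFun.cauchySeq
    rw [EMetric.cauchySeq_iff] at this ⊢
    simpa only [Lp.edist_toLp_toLp, StepFunction.eLpNorm_integral_sub hB] using this
  obtain ⟨I, hI⟩ := cauchySeq_tendsto_of_complete hcauchy
  refine ⟨I, Lp.memLp I, φ, hφ0, ?_⟩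
  rw [← Lp.toLp_coeFn I (Lp.memLp I)] at hI
  have := (Lp.tendsto_Lp_iff_tendsto_eLpNorm'' _ _ _ _).1 hI
  refine this.congr fun n => ?_
  rw [← eLpNorm_neg, neg_sub]
  rfl

lemma isWienerIntegral_wienerIntegral (hB : IsTwoSidedBrownian B P) (hf : MemLp f 2 volume) :
    IsWienerIntegral P B f (wienerIntegral P B f) := by
  rw [wienerIntegral, dif_pos (exists_isWienerIntegral hB hf)]
  exact (exists_isWienerIntegral hB hf).choose_spec

end Existence

/-! ### Cross-covariances of moving averages with stationary increments -/

/-- The increment of the moving average kernel `g` between the times `b` and `a`. -/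
def kernelIncr (g : ℝ → ℝ) (a b x : ℝ) : ℝ := g (a - x) - g (b - x)

/-- The moving average with kernel `g` has square integrable increments. -/
def SqIntegrableIncr (g : ℝ → ℝ) : Prop := ∀ a b, MemLp (kernelIncr g a b) 2 volume

/-- The covariance of the increments of the moving averages with kernels `g` and `h` is the
(mixed) second difference of `V`. -/
def HasCross (g h V : ℝ → ℝ) : Prop :=
  ∀ a b c d, ∫ x, kernelIncr g a b x * kernelIncr h c d x =
    V (a - d) + V (b - c) - V (a - c) - V (b - d)

/-- The substitution `y = b - x` turns the increment between `b` and `a` into a shift by `a - b`;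
exchanging the times only changes the sign. -/
lemma sqIntegrableIncr_of_shift {g : ℝ → ℝ}
    (h : ∀ v, 0 < v → MemLp (fun y => g (v + y) - g y) 2 volume) : SqIntegrableIncr g := by
  have key : ∀ a b, b < a → MemLp (kernelIncr g a b) 2 volume := by
    intro a b hab
    have := (h (a - b) (sub_pos.2 hab)).comp_measurePreserving
      (Measure.measurePreserving_sub_left volume b)
    convert this using 1
    ext x
    simp only [kernelIncr, Function.comp_apply]
    congr 2
    ring
  intro a b
  rcases lt_trichotomy a b with hab | rfl | hab
  · convert (key b a hab).neg using 1
    ext x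
    simp [kernelIncr]
  · convert MemLp.zero (ε := ℝ) (p := 2) (μ := volume) using 1
    ext x
    simp [kernelIncr]
  · exact key a b hab

namespace SqIntegrableIncr

variable {g h : ℝ → ℝ}

lemma add (hg : SqIntegrableIncr g) (hh : SqIntegrableIncr h) :
    SqIntegrableIncr fun y => g y + h y := fun a b => by
  convert (hg a b).add (hh a b) using 1
  ext x
  simp only [kernelIncr, Pi.add_apply]
  ring

lemma const_mul (hg : SqIntegrableIncr g) (c : ℝ) : SqIntegrableIncr fun y => c * g y :=
  fun a b => by
  convert (hg a b).const_mul c using 1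
  ext x
  simp only [kernelIncr]
  ring

lemma comp_neg (hg : SqIntegrableIncr g) : SqIntegrableIncr fun y => g (-y) := fun a b => by
  convert (hg (-a) (-b)).comp_measurePreserving (Measure.measurePreserving_neg volume) using 1
  ext x
  simp only [kernelIncr, Function.comp_apply]
  congr 2 <;> ring

end SqIntegrableIncr

namespace HasCross

variable {g g' h V V' : ℝ → ℝ}

lemma congr (hV : HasCross g h V) (e : ∀ u, V u = V' u) : HasCross g h V' := by
  rwa [← funext e]

/-- The arguments `a - d`, `b - c` and `a - c`, `b - d` have equal sums. This freedom is what later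
absorbs the pole at `a + b = 0`. -/
lemma add_linear (hV : HasCross g h V) (m : ℝ) : HasCross g h fun u => V u + m * u := by
  intro a b c d
  rw [hV a b c d]
  ring

lemma swap (hV : HasCross g h V) : HasCross h g fun u => V (-u) := by
  intro a b c d
  simp_rw [mul_comm (kernelIncr h a b _)]
  rw [hV c d a b]
  simp only [neg_sub]
  ring

lemma add_left (hg : SqIntegrableIncr g) (hg' : SqIntegrableIncr g') (hh : SqIntegrableIncr h)
    (hV : HasCross g h V) (hV' : HasCross g' h V') :
    HasCross (fun y => g y + g' y) h fun u => V u + V' u := by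
  intro a b c d
  have : ∀ x, kernelIncr (fun y => g y + g' y) a b x * kernelIncr h c d x =
      kernelIncr g a b x * kernelIncr h c d x + kernelIncr g' a b x * kernelIncr h c d x := by
    intro x
    simp only [kernelIncr]
    ring
  simp_rw [this]
  rw [integral_add (integrable_mul_of_memLp_two (hg a b) (hh c d))
    (integrable_mul_of_memLp_two (hg' a b) (hh c d)), hV a b c d, hV' a b c d]
  ring

lemma add_right (hg : SqIntegrableIncr g) (hg' : SqIntegrableIncr g') (hh : SqIntegrableIncr h)
    (hV : HasCross h g V) (hV' : HasCross h g' V') :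
    HasCross h (fun y => g y + g' y) fun u => V u + V' u :=
  (add_left hg hg' hh hV.swap hV'.swap).swap.congr fun u => by simp

lemma const_mul_left (hV : HasCross g h V) (m : ℝ) :
    HasCross (fun y => m * g y) h fun u => m * V u := by
  intro a b c d
  have : ∀ x, kernelIncr (fun y => m * g y) a b x * kernelIncr h c d x =
      m * (kernelIncr g a b x * kernelIncr h c d x) := by
    intro x
    simp only [kernelIncr]
    ring
  simp_rw [this]
  rw [integral_const_mul, hV a b c d]
  ring

lemma const_mul_right (hV : HasCross g h V) (m : ℝ) :
    HasCross g (fun y => m * h y) fun u => m * V u :=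
  (hV.swap.const_mul_left m).swap.congr fun u => by simp

lemma comp_neg (hV : HasCross g h V) :
    HasCross (fun y => g (-y)) (fun y => h (-y)) fun u => V (-u) := by
  intro a b c d
  have e : ∀ (k : ℝ → ℝ) (p q x : ℝ), kernelIncr (fun y => k (-y)) p q x =
      kernelIncr k (-p) (-q) (-x) := by
    intro k p q x
    simp only [kernelIncr]
    congr 2 <;> ring
  simp_rw [e]
  rw [integral_neg_eq_self (fun x => kernelIncr g (-a) (-b) x * kernelIncr h (-c) (-d) x), hV]
  simp only [neg_sub_neg, neg_sub]

/-- Cross-covariances pass to dominated limits of the kernel. -/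
lemma of_tendsto {ι : Type*} {l : Filter ι} [l.NeBot] [l.IsCountablyGenerated]
    {G W : ι → ℝ → ℝ} (hh : SqIntegrableIncr h) (hG : ∀ᶠ i in l, HasCross (G i) h (W i))
    (hm : ∀ i, Measurable (G i))
    (hb : ∀ a b, ∃ F : ℝ → ℝ, MemLp F 2 volume ∧
      ∀ᶠ i in l, ∀ᵐ x, |kernelIncr (G i) a b x| ≤ F x)
    (hlim : ∀ᵐ y, Tendsto (fun i => G i y) l (𝓝 (g y)))
    (hW : ∀ u, Tendsto (fun i => W i u) l (𝓝 (V u))) : HasCross g h V := by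
  intro a b c d
  obtain ⟨F, hF, hbF⟩ := hb a b
  have h1 : Tendsto (fun i => ∫ x, kernelIncr (G i) a b x * kernelIncr h c d x) l
      (𝓝 (∫ x, kernelIncr g a b x * kernelIncr h c d x)) := by
    refine tendsto_integral_filter_of_dominated_convergence
      (fun x => F x * ‖kernelIncr h c d x‖) (Eventually.of_forall fun i => ?_) ?_
      (integrable_mul_of_memLp_two hF (hh c d).norm) ?_
    · refine AEStronglyMeasurable.mul ?_ (hh c d).1
      have := hm i
      unfold kernelIncr
      fun_prop
    · filter_upwards [hbF] with i hi
      filter_upwards [hi] with x hx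
      rw [norm_mul]
      gcongr
      exact hx
    -- Reflection and translation preserve null sets, so almost everywhere convergence of the
    -- kernels themselves passes to their increments.
    · have shift : ∀ p : ℝ, ∀ᵐ x, Tendsto (fun i => G i (p - x)) l (𝓝 (g (p - x))) := fun p =>
        (Measure.measurePreserving_sub_left volume p).quasiMeasurePreserving.ae hlim
      filter_upwards [shift a, shift b] with x hxa hxb
      exact (hxa.sub hxb).mul_const _
  have h2 : Tendsto (fun i => W i (a - d) + W i (b - c) - W i (a - c) - W i (b - d)) l
      (𝓝 (V (a - d) + V (b - c) - V (a - c) - V (b - d))) :=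
    (((hW _).add (hW _)).sub (hW _)).sub (hW _)
  refine tendsto_nhds_unique h1 (h2.congr' ?_)
  filter_upwards [hG] with i hi
  rw [hi a b c d]

end HasCross

/-! ### One-sided powers -/

lemma posPow_of_pos {x : ℝ} (hx : 0 < x) (β : ℝ) : posPow x β = x ^ β := if_pos hx

lemma posPow_of_nonpos {x : ℝ} (hx : x ≤ 0) (β : ℝ) : posPow x β = 0 := if_neg hx.not_gt

lemma posPow_nonneg (x β : ℝ) : 0 ≤ posPow x β := by
  unfold posPow
  split_ifs with h
  · exact Real.rpow_nonneg h.le β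
  · exact le_rfl

lemma posPow_mul_posPow (x α β : ℝ) : posPow x α * posPow x β = posPow x (α + β) := by
  unfold posPow
  split_ifs with h
  · rw [Real.rpow_add h]
  · simp

@[fun_prop]
lemma measurable_posPow (β : ℝ) : Measurable fun x => posPow x β :=
  Measurable.ite measurableSet_Ioi (by fun_prop) (by fun_prop)

lemma posPow_eq_indicator (β : ℝ) :
    (fun x => posPow x β) = (Set.Ioi 0).indicator fun x => x ^ β := by
  ext x
  simp [posPow, Set.indicator_apply]

lemma intervalIntegrable_posPow {γ : ℝ} (hγ : -1 < γ) (a b : ℝ) :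
    IntervalIntegrable (fun x => posPow x γ) volume a b := by
  rw [posPow_eq_indicator, intervalIntegrable_iff]
  exact (intervalIntegrable_iff.1 (intervalIntegral.intervalIntegrable_rpow' hγ)).indicator
    measurableSet_Ioi

lemma integral_posPow {γ : ℝ} (hγ : -1 < γ) (a b : ℝ) :
    ∫ x in a..b, posPow x γ = (posPow b (γ + 1) - posPow a (γ + 1)) / (γ + 1) := by
  have key : ∀ b, ∫ x in (0 : ℝ)..b, posPow x γ = posPow b (γ + 1) / (γ + 1) := by
    intro b
    rcases lt_or_ge 0 b with hb | hb
    · rw [posPow_of_pos hb]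
      have : ∫ x in (0 : ℝ)..b, posPow x γ = ∫ x in (0 : ℝ)..b, x ^ γ := by
        refine intervalIntegral.integral_congr_ae (ae_of_all _ fun x hx => ?_)
        rw [Set.uIoc_of_le hb.le] at hx
        exact posPow_of_pos hx.1 γ
      rw [this, integral_rpow (Or.inl hγ), Real.zero_rpow (by linarith), sub_zero]
    · rw [posPow_of_nonpos hb, zero_div]
      refine intervalIntegral.integral_zero_ae (ae_of_all _ fun x hx => ?_)
      rw [Set.uIoc_of_ge hb] at hx
      exact posPow_of_nonpos hx.2 γ
  rw [← intervalIntegral.integral_interval_sub_left (intervalIntegrable_posPow hγ 0 b)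
    (intervalIntegrable_posPow hγ 0 a), key, key, sub_div]

/-- The factor `α` stays outside so that the identity also holds at `α = 0`, where the power
primitive would divide by zero. -/
lemma rpow_add_sub_rpow (α : ℝ) {y v : ℝ} (hy : 0 < y) (hv : 0 ≤ v) :
    (v + y) ^ α - y ^ α = α * ∫ r in (0 : ℝ)..v, (y + r) ^ (α - 1) := by
  rcases eq_or_ne α 0 with rfl | hα
  · simp
  · have h0 : (0 : ℝ) ∉ Set.uIcc (y + 0) (y + v) := by
      rw [Set.uIcc_of_le (by linarith)]
      exact fun h => by linarith [h.1]
    rw [intervalIntegral.integral_comp_add_left (fun x => x ^ (α - 1)) y,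
      integral_rpow (Or.inr ⟨by contrapose! hα; linarith, h0⟩)]
    simp only [sub_add_cancel, add_zero]
    rw [mul_div_cancel₀ _ hα, add_comm v y]

lemma abs_rpow_add_sub_rpow_le {α : ℝ} (hα : α ≤ 1) {y v : ℝ} (hy : 0 < y) (hv : 0 ≤ v) :
    |(v + y) ^ α - y ^ α| ≤ |α| * v * y ^ (α - 1) := by
  rw [rpow_add_sub_rpow α hy hv, abs_mul, mul_assoc]
  gcongr
  have := intervalIntegral.norm_integral_le_of_norm_le_const (a := 0) (b := v)
    (f := fun r => (y + r) ^ (α - 1)) (C := y ^ (α - 1)) (fun r hr => by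
      rw [Set.uIoc_of_le hv] at hr
      rw [Real.norm_of_nonneg (Real.rpow_nonneg (by linarith [hr.1]) _)]
      exact Real.rpow_le_rpow_of_nonpos hy (by linarith [hr.1]) (by linarith))
  rw [sub_zero, abs_of_nonneg hv, Real.norm_eq_abs, mul_comm] at this
  exact this

/-- Near the singularities the square has exponent `2 * α > -1`. At infinity the mean value bound
gives decay of order `y ^ (2 * (α - 1))`, integrable because `α < 1 / 2`. -/
lemma sqIntegrableIncr_posPow {α : ℝ} (h1 : -(1 / 2) < α) (h2 : α < 1 / 2) :
    SqIntegrableIncr fun y => posPow y α := by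
  refine sqIntegrableIncr_of_shift fun v hv => ?_
  have hm : Measurable fun y => posPow (v + y) α - posPow y α := by fun_prop
  rw [memLp_two_iff_integrable_sq hm.aestronglyMeasurable, ← integrableOn_univ,
    ← Set.Iic_union_Ioi (a := (1 : ℝ)), ← Set.Iic_union_Ioc_eq_Iic (show -v ≤ 1 by linarith)]
  have hm2 : Measurable fun y => (posPow (v + y) α - posPow y α) ^ 2 := hm.pow_const 2
  refine (IntegrableOn.union ?_ ?_).union ?_
  · refine (integrableOn_zero (ε' := ℝ)).congr_fun (fun y hy => ?_) measurableSet_Iic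
    have hy : y ≤ -v := hy
    simp [posPow_of_nonpos (show v + y ≤ 0 by linarith), posPow_of_nonpos (show y ≤ 0 by linarith)]
  · have i1 := intervalIntegrable_posPow (γ := α + α) (by linarith) (-v) 1
    have i2 := (intervalIntegrable_posPow (γ := α + α) (by linarith) 0 (v + 1)).comp_add_left v
    simp only [zero_sub, add_sub_cancel_left] at i2
    rw [intervalIntegrable_iff_integrableOn_Ioc_of_le (by linarith)] at i1 i2
    refine ((i2.const_mul 2).add (i1.const_mul 2)).mono' hm2.aestronglyMeasurable
      (ae_of_all _ fun y => ?_)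
    rw [Real.norm_of_nonneg (sq_nonneg _)]
    simp only [Pi.add_apply, ← posPow_mul_posPow]
    nlinarith [sq_nonneg (posPow (v + y) α + posPow y α)]
  · have i1 := (integrableOn_Ioi_rpow_of_lt (a := 2 * (α - 1)) (by linarith) one_pos).const_mul
      ((|α| * v) ^ 2)
    refine i1.mono' hm2.aestronglyMeasurable (ae_restrict_of_forall_mem measurableSet_Ioi
      fun y hy => ?_)
    have hy : (1 : ℝ) < y := hy
    have hy0 : 0 < y := by linarith
    rw [Real.norm_of_nonneg (sq_nonneg _), posPow_of_pos hy0, posPow_of_pos (by linarith),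
      mul_comm 2 (α - 1), Real.rpow_mul hy0.le, Real.rpow_two, ← mul_pow]
    exact sq_le_sq' (neg_le_of_abs_le (abs_rpow_add_sub_rpow_le (by linarith) hy0 hv.le))
      (le_of_abs_le (abs_rpow_add_sub_rpow_le (by linarith) hy0 hv.le))

/-! ### Beta integrals -/

/-- A nonintegrable function has integral `0` by convention, so the positive value of the Gamma
integral already forces integrability. -/
lemma integrableOn_rpow_mul_exp_neg_mul {p r : ℝ} (hp : 0 < p) (hr : 0 < r) :
    IntegrableOn (fun t : ℝ => t ^ (p - 1) * Real.exp (-(r * t))) (Set.Ioi 0) := by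
  refine Integrable.of_integral_ne_zero ?_
  rw [Real.integral_rpow_mul_exp_neg_mul_Ioi hp hr]
  have := Real.Gamma_pos_of_pos hp
  positivity

/-- Integrating first over `y` leaves `Γ(p) * s ^ (q - p - 1) * exp (-r s)`, which is integrable
since `p < q`; the integrand is nonnegative, so this order suffices. -/
lemma integrable_gamma_beta_kernel {p q r : ℝ} (hp : 0 < p) (hpq : p < q) (hr : 0 < r) :
    Integrable (fun z : ℝ × ℝ => z.1 ^ (p - 1) * (z.2 ^ (q - 1) * Real.exp (-((z.1 + r) * z.2))))
      ((volume.restrict (Set.Ioi 0)).prod (volume.restrict (Set.Ioi 0))) := by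
  have hm : Measurable fun z : ℝ × ℝ =>
      z.1 ^ (p - 1) * (z.2 ^ (q - 1) * Real.exp (-((z.1 + r) * z.2))) := by fun_prop
  have split : ∀ s y : ℝ, y ^ (p - 1) * (s ^ (q - 1) * Real.exp (-((y + r) * s))) =
      s ^ (q - 1) * Real.exp (-(r * s)) * (y ^ (p - 1) * Real.exp (-(s * y))) := by
    intro s y
    rw [show -((y + r) * s) = -(r * s) + -(s * y) by ring, Real.exp_add]
    ring
  rw [integrable_prod_iff' hm.aestronglyMeasurable]
  simp only [split]
  constructor
  · refine ae_restrict_of_forall_mem measurableSet_Ioi fun s hs => ?_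
    exact (integrableOn_rpow_mul_exp_neg_mul hp hs).const_mul _
  · refine ((integrableOn_rpow_mul_exp_neg_mul (sub_pos.2 hpq) hr).const_mul
      (Real.Gamma p)).congr (ae_restrict_of_forall_mem measurableSet_Ioi fun s hs => ?_)
    have hs : 0 < s := hs
    have : ∀ y ∈ Set.Ioi (0 : ℝ), ‖s ^ (q - 1) * Real.exp (-(r * s)) *
        (y ^ (p - 1) * Real.exp (-(s * y)))‖ = s ^ (q - 1) * Real.exp (-(r * s)) *
        (y ^ (p - 1) * Real.exp (-(s * y))) := fun y hy => by
      have hy : 0 < y := hy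
      exact Real.norm_of_nonneg (by positivity)
    simp only
    rw [setIntegral_congr_fun measurableSet_Ioi this, integral_const_mul,
      Real.integral_rpow_mul_exp_neg_mul_Ioi hp hs, one_div, Real.inv_rpow hs.le,
      show q - p - 1 = (q - 1) + -p by ring, Real.rpow_add hs, Real.rpow_neg hs.le]
    ring

lemma integrableOn_rpow_mul_add_rpow {p q r : ℝ} (hp : 0 < p) (hpq : p < q) (hr : 0 < r) :
    IntegrableOn (fun y : ℝ => y ^ (p - 1) * (y + r) ^ (-q)) (Set.Ioi 0) := by
  have hq : 0 < q := hp.trans hpq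
  have hG := Real.Gamma_pos_of_pos hq
  refine ((integrable_gamma_beta_kernel hp hpq hr).integral_prod_left.const_mul
    (Real.Gamma q)⁻¹).congr (ae_restrict_of_forall_mem measurableSet_Ioi fun y hy => ?_)
  have hy : 0 < y := hy
  have hyr : 0 < y + r := by positivity
  simp only
  rw [integral_const_mul, Real.integral_rpow_mul_exp_neg_mul_Ioi hq hyr, one_div,
    Real.inv_rpow hyr.le, Real.rpow_neg hyr.le]
  field_simp

/-- A Beta integral of the second kind: `(y + r) ^ (-q)` is replaced by its Gamma integral and the
order of integration exchanged. -/
lemma integral_rpow_mul_add_rpow {p q r : ℝ} (hp : 0 < p) (hpq : p < q) (hr : 0 < r) :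
    ∫ y in Set.Ioi 0, y ^ (p - 1) * (y + r) ^ (-q) =
      Real.Gamma p * Real.Gamma (q - p) / Real.Gamma q * r ^ (p - q) := by
  have hq : 0 < q := hp.trans hpq
  have hG := Real.Gamma_pos_of_pos hq
  have h := integral_integral_swap (f := fun y s : ℝ =>
    y ^ (p - 1) * (s ^ (q - 1) * Real.exp (-((y + r) * s))))
    (integrable_gamma_beta_kernel hp hpq hr)
  have h1 : ∀ y ∈ Set.Ioi (0 : ℝ), ∫ s in Set.Ioi 0,
      y ^ (p - 1) * (s ^ (q - 1) * Real.exp (-((y + r) * s))) =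
      Real.Gamma q * (y ^ (p - 1) * (y + r) ^ (-q)) := by
    intro y hy
    have hy : 0 < y := hy
    have hyr : 0 < y + r := by positivity
    rw [integral_const_mul, Real.integral_rpow_mul_exp_neg_mul_Ioi hq hyr, one_div,
      Real.inv_rpow hyr.le, Real.rpow_neg hyr.le]
    ring
  have h2 : ∀ s ∈ Set.Ioi (0 : ℝ), ∫ y in Set.Ioi 0,
      y ^ (p - 1) * (s ^ (q - 1) * Real.exp (-((y + r) * s))) =
      Real.Gamma p * (s ^ (q - p - 1) * Real.exp (-(r * s))) := by
    intro s hs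
    have hs : 0 < s := hs
    have split : ∀ y : ℝ, y ^ (p - 1) * (s ^ (q - 1) * Real.exp (-((y + r) * s))) =
        s ^ (q - 1) * Real.exp (-(r * s)) * (y ^ (p - 1) * Real.exp (-(s * y))) := by
      intro y
      rw [show -((y + r) * s) = -(r * s) + -(s * y) by ring, Real.exp_add]
      ring
    simp only [split]
    rw [integral_const_mul, Real.integral_rpow_mul_exp_neg_mul_Ioi hp hs, one_div,
      Real.inv_rpow hs.le, show q - p - 1 = (q - 1) + -p by ring, Real.rpow_add hs,
      Real.rpow_neg hs.le]
    ring
  rw [setIntegral_congr_fun measurableSet_Ioi h1, setIntegral_congr_fun measurableSet_Ioi h2,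
    integral_const_mul, integral_const_mul,
    Real.integral_rpow_mul_exp_neg_mul_Ioi (sub_pos.2 hpq) hr, one_div, Real.inv_rpow hr.le,
    ← Real.rpow_neg hr.le, neg_sub] at h
  rw [← mul_right_inj' hG.ne', h]
  field_simp

/-- The coefficient of the one-sided power in the cross-covariance of one-sided powers. -/
noncomputable def crossCoeff (a b : ℝ) : ℝ :=
  Real.Gamma (a + 1) * Real.Gamma (b + 1) * Real.sin (Real.pi * a) /
    (Real.sin (Real.pi * (a + b + 1)) * Real.Gamma (a + b + 2))

/-- The right side is what the Beta integral produces. Two reflection formulas, at `a + b + 1` and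
at `a`, convert it; `a = 0` is separate because the second one degenerates there, while both sides
vanish. -/
lemma crossCoeff_eq {a b : ℝ} (ha : -1 < a) (ha1 : a < 1) (hab : -1 < a + b) (hab0 : a + b < 0) :
    crossCoeff a b =
      a * (Real.Gamma (b + 1) * Real.Gamma (-a - b) / Real.Gamma (1 - a)) / (a + b + 1) := by
  have hH : 0 < a + b + 1 := by linarith
  have hsin : Real.sin (Real.pi * (a + b + 1)) ≠ 0 :=
    (Real.sin_pos_of_pos_of_lt_pi (by positivity) (by nlinarith [Real.pi_pos])).ne'
  have r1 := Real.Gamma_mul_Gamma_one_sub (a + b + 1)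
  rw [show 1 - (a + b + 1) = -a - b by ring] at r1
  have g1 := Real.Gamma_add_one hH.ne'
  rw [show a + b + 1 + 1 = a + b + 2 by ring] at g1
  have hGH := Real.Gamma_pos_of_pos hH
  rcases eq_or_ne a 0 with rfl | ha0
  · simp [crossCoeff]
  have hsina : Real.sin (Real.pi * a) ≠ 0 := by
    rw [Ne, Real.sin_eq_zero_iff_of_lt_of_lt (by nlinarith [Real.pi_pos])
      (by nlinarith [Real.pi_pos])]
    have := Real.pi_pos.ne'
    positivity
  have r2 := Real.Gamma_mul_Gamma_one_sub a
  have g2 := Real.Gamma_add_one ha0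
  have hG1 := Real.Gamma_pos_of_pos (show 0 < 1 - a by linarith)
  rw [eq_div_iff hsin] at r1
  rw [eq_div_iff hsina] at r2
  rw [crossCoeff, g1, g2]
  generalize Real.sin (Real.pi * a) = sa at *
  field_simp
  linear_combination (Real.Gamma (b + 1)) * r2 - Real.Gamma (b + 1) * r1

/-! ### A power integrated against the difference of two powers -/

section PowerDifference

variable {a b v : ℝ}

/-- The condition `a + b < 0` makes the `y`-integral converge at infinity; it is then a multiple of
`r ^ (a + b)`, integrable at the origin because `-1 < a + b`. -/
lemma integrable_powerDifference_kernel (hb : -1 < b) (hab : -1 < a + b) (hab0 : a + b < 0)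
    (hv : 0 ≤ v) :
    Integrable (fun z : ℝ × ℝ => z.1 ^ b * (z.1 + z.2) ^ (a - 1))
      ((volume.restrict (Set.Ioi 0)).prod (volume.restrict (Set.Ioc 0 v))) := by
  have hm : Measurable fun z : ℝ × ℝ => z.1 ^ b * (z.1 + z.2) ^ (a - 1) := by fun_prop
  rw [integrable_prod_iff' hm.aestronglyMeasurable]
  constructor
  · refine ae_restrict_of_forall_mem measurableSet_Ioc fun r hr => ?_
    have := integrableOn_rpow_mul_add_rpow (p := b + 1) (q := 1 - a) (by linarith) (by linarith)
      hr.1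
    simpa [IntegrableOn] using this
  · have i1 : IntegrableOn (fun r : ℝ => r ^ (a + b)) (Set.Ioc 0 v) := by
      rw [← intervalIntegrable_iff_integrableOn_Ioc_of_le hv]
      exact intervalIntegral.intervalIntegrable_rpow' hab
    refine (i1.const_mul (Real.Gamma (b + 1) * Real.Gamma (1 - a - (b + 1)) /
      Real.Gamma (1 - a))).congr (ae_restrict_of_forall_mem measurableSet_Ioc fun r hr => ?_)
    have : ∀ y ∈ Set.Ioi (0 : ℝ), ‖y ^ b * (y + r) ^ (a - 1)‖ =
        y ^ (b + 1 - 1) * (y + r) ^ (-(1 - a)) := fun y hy => by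
      have hy : 0 < y := hy
      have hr : 0 < r := hr.1
      rw [Real.norm_of_nonneg (by positivity), add_sub_cancel_right, neg_sub]
    simp only
    rw [setIntegral_congr_fun measurableSet_Ioi this,
      integral_rpow_mul_add_rpow (by linarith) (by linarith) hr.1]
    ring_nf

lemma integrableOn_rpow_mul_rpow_sub_rpow (hb : -1 < b) (hab : -1 < a + b) (hab0 : a + b < 0)
    (hv : 0 ≤ v) :
    IntegrableOn (fun y : ℝ => y ^ b * ((v + y) ^ a - y ^ a)) (Set.Ioi 0) := by
  refine ((integrable_powerDifference_kernel hb hab hab0 hv).integral_prod_left.const_mul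
    a).congr (ae_restrict_of_forall_mem measurableSet_Ioi fun y hy => ?_)
  simp only
  rw [integral_const_mul, rpow_add_sub_rpow a hy hv, intervalIntegral.integral_of_le hv]
  ring

/-- The difference of powers is `a * ∫ (y + r) ^ (a - 1)` over `0 < r ≤ v`. After exchanging the
integrals, the inner one is the Beta integral and the outer one that of `r ^ (a + b)`. -/
lemma integral_rpow_mul_rpow_sub_rpow (ha : -1 < a) (hb : -1 < b) (hab : -1 < a + b)
    (hab0 : a + b < 0) (hv : 0 < v) :
    ∫ y in Set.Ioi 0, y ^ b * ((v + y) ^ a - y ^ a) = crossCoeff a b * v ^ (a + b + 1) := by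
  have h := integral_integral_swap (f := fun y r : ℝ => y ^ b * (y + r) ^ (a - 1))
    (integrable_powerDifference_kernel hb hab hab0 hv.le)
  have h1 : ∀ y ∈ Set.Ioi (0 : ℝ), y ^ b * ((v + y) ^ a - y ^ a) =
      a * ∫ r in Set.Ioc 0 v, y ^ b * (y + r) ^ (a - 1) := by
    intro y hy
    rw [integral_const_mul, rpow_add_sub_rpow a hy hv.le, intervalIntegral.integral_of_le hv.le]
    ring
  have h2 : ∀ r ∈ Set.Ioc 0 v, ∫ y in Set.Ioi 0, y ^ b * (y + r) ^ (a - 1) =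
      Real.Gamma (b + 1) * Real.Gamma (-a - b) / Real.Gamma (1 - a) * r ^ (a + b) := by
    intro r hr
    have := integral_rpow_mul_add_rpow (p := b + 1) (q := 1 - a) (by linarith) (by linarith) hr.1
    rw [add_sub_cancel_right, neg_sub, show 1 - a - (b + 1) = -a - b by ring,
      show b + 1 - (1 - a) = a + b by ring] at this
    exact this
  rw [setIntegral_congr_fun measurableSet_Ioi h1, integral_const_mul, h,
    setIntegral_congr_fun measurableSet_Ioc h2, integral_const_mul,
    ← intervalIntegral.integral_of_le hv.le, integral_rpow (Or.inl hab),
    Real.zero_rpow (by linarith), crossCoeff_eq ha (by linarith) hab hab0]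
  ring

end PowerDifference

/-! ### Cross-covariances of one-sided powers -/

/-- The function whose negative second differences are the cross-covariances of the increments of
one-sided powers. -/
noncomputable def crossPow (a b u : ℝ) : ℝ :=
  crossCoeff a b * posPow u (a + b + 1) + crossCoeff b a * posPow (-u) (a + b + 1)

lemma crossPow_neg (a b u : ℝ) : crossPow a b (-u) = crossPow b a u := by
  rw [crossPow, crossPow, neg_neg, add_comm b a, add_comm]

lemma crossPow_of_pos {a b u : ℝ} (hu : 0 < u) :
    crossPow a b u = crossCoeff a b * u ^ (a + b + 1) := by
  rw [crossPow, posPow_of_pos hu, posPow_of_nonpos (by linarith), mul_zero, add_zero]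

lemma crossPow_zero (a b : ℝ) : crossPow a b 0 = 0 := by
  simp [crossPow, posPow]

/-! ### Products of powers made integrable at infinity by subtraction -/

section Regularized

variable {a b v : ℝ}

lemma posPow_mul_sub_posPow_eq_indicator (hv : 0 < v) :
    (fun y => posPow (v + y) a * posPow y b - posPow y (a + b)) =
      (Set.Ioi 0).indicator fun y => y ^ b * ((v + y) ^ a - y ^ a) := by
  ext y
  rcases lt_or_ge 0 y with hy | hy
  · rw [Set.indicator_of_mem (show y ∈ Set.Ioi 0 from hy), posPow_of_pos (by linarith), posPow_of_pos hy, posPow_of_pos hy,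
      Real.rpow_add hy]
    ring
  · rw [Set.indicator_of_notMem (by simpa using hy), posPow_of_nonpos hy, posPow_of_nonpos hy]
    simp

lemma integrable_posPow_mul_sub_posPow (hb : -1 < b) (hab : -1 < a + b) (hab0 : a + b < 0)
    (hv : 0 < v) :
    Integrable fun y => posPow (v + y) a * posPow y b - posPow y (a + b) := by
  rw [posPow_mul_sub_posPow_eq_indicator hv, integrable_indicator_iff measurableSet_Ioi]
  exact integrableOn_rpow_mul_rpow_sub_rpow hb hab hab0 hv.le

lemma integral_posPow_mul_sub_posPow (ha : -1 < a) (hb : -1 < b) (hab : -1 < a + b)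
    (hab0 : a + b < 0) (hv : 0 < v) :
    ∫ y, (posPow (v + y) a * posPow y b - posPow y (a + b)) =
      crossCoeff a b * v ^ (a + b + 1) := by
  rw [posPow_mul_sub_posPow_eq_indicator hv, integral_indicator measurableSet_Ioi]
  exact integral_rpow_mul_rpow_sub_rpow ha hb hab hab0 hv

end Regularized

/-! ### Translating the subtracted power -/

section Translate

variable {γ : ℝ}

/-- Translation costs nothing although neither power is integrable alone: the part on `(-c, 0]`
contributes `c ^ (γ + 1) / (γ + 1)`, and the part on the positive half-line contributes its
negative, by the previous integral with `b = 0`. -/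
lemma posPow_add_sub_posPow_of_pos (hγ : -1 < γ) (hγ0 : γ < 0) {c : ℝ} (hc : 0 < c) :
    Integrable (fun y => posPow (c + y) γ - posPow y γ) ∧
      ∫ y, (posPow (c + y) γ - posPow y γ) = 0 := by
  have hsupp : ∀ y, y ∉ Set.Ioi (-c) → posPow (c + y) γ - posPow y γ = 0 := by
    intro y hy
    have hy : y ≤ -c := by simpa using hy
    rw [posPow_of_nonpos (by linarith), posPow_of_nonpos (by linarith), sub_zero]
  have hneg : Set.EqOn (fun y => posPow (c + y) γ - posPow y γ) (fun y => posPow (c + y) γ)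
      (Set.Ioc (-c) 0) := fun y hy => by
    simp only
    rw [posPow_of_nonpos hy.2, sub_zero]
  have hpos : Set.EqOn (fun y => posPow (c + y) γ - posPow y γ)
      (fun y => y ^ (0 : ℝ) * ((c + y) ^ γ - y ^ γ)) (Set.Ioi 0) := fun y hy => by
    have hy : 0 < y := hy
    simp only
    rw [posPow_of_pos (by linarith), posPow_of_pos hy, Real.rpow_zero, one_mul]
  have i0 : IntegrableOn (fun y => posPow (c + y) γ) (Set.Ioc (-c) 0) := by
    have := (intervalIntegrable_posPow hγ 0 c).comp_add_left c
    rw [zero_sub, sub_self, intervalIntegrable_iff_integrableOn_Ioc_of_le (by linarith)] at this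
    exact this
  have i1 : IntegrableOn (fun y => posPow (c + y) γ - posPow y γ) (Set.Ioc (-c) 0) :=
    i0.congr_fun hneg.symm measurableSet_Ioc
  have i2 : IntegrableOn (fun y => posPow (c + y) γ - posPow y γ) (Set.Ioi 0) :=
    (integrableOn_rpow_mul_rpow_sub_rpow (a := γ) (b := 0) (by linarith) (by linarith)
      (by linarith) hc.le).congr_fun hpos.symm measurableSet_Ioi
  have hunion : Set.Ioc (-c) 0 ∪ Set.Ioi 0 = Set.Ioi (-c) :=
    Set.Ioc_union_Ioi_eq_Ioi (by linarith)
  constructor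
  · rw [← integrableOn_iff_integrable_of_support_subset (s := Set.Ioi (-c)), ← hunion]
    · exact i1.union i2
    · intro y hy
      by_contra h
      exact hy (hsupp y h)
  · rw [← setIntegral_eq_integral_of_forall_compl_eq_zero hsupp, ← hunion,
      setIntegral_union (Set.Ioc_disjoint_Ioi le_rfl) measurableSet_Ioi i1 i2,
      setIntegral_congr_fun measurableSet_Ioc hneg, setIntegral_congr_fun measurableSet_Ioi hpos,
      integral_rpow_mul_rpow_sub_rpow hγ (by linarith) (by linarith) (by linarith) hc,
      ← intervalIntegral.integral_of_le (by linarith),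
      intervalIntegral.integral_comp_add_left (fun z => posPow z γ) c, add_neg_cancel, add_zero,
      integral_posPow hγ, posPow_of_pos hc, posPow_of_nonpos le_rfl,
      crossCoeff_eq hγ (by linarith) (by linarith) (by linarith)]
    have hG := Real.Gamma_pos_of_pos (show 0 < -γ by linarith)
    have := Real.Gamma_add_one (show -γ ≠ 0 by linarith)
    rw [show 1 - γ = -γ + 1 by ring, this, zero_add, Real.Gamma_one, sub_zero, sub_zero, add_zero]
    have h1 : γ + 1 ≠ 0 := by linarith
    have h2 := hγ0.ne
    field_simp
    ring

lemma posPow_sub_sub_posPow_neg (hγ : -1 < γ) (hγ0 : γ < 0) (c : ℝ) :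
    Integrable (fun x => posPow (c - x) γ - posPow (-x) γ) ∧
      ∫ x, (posPow (c - x) γ - posPow (-x) γ) = 0 := by
  rcases lt_trichotomy c 0 with hc | rfl | hc
  · obtain ⟨h1, h2⟩ := posPow_add_sub_posPow_of_pos hγ hγ0 (neg_pos.2 hc)
    have e : ∀ x, posPow (c - x) γ - posPow (-x) γ =
        -(posPow (-c + (c - x)) γ - posPow (c - x) γ) := fun x => by
      rw [show -c + (c - x) = -x by ring]
      ring
    simp_rw [e]
    refine ⟨(h1.comp_sub_left c).neg, ?_⟩
    rw [integral_neg, integral_sub_left_eq_self (fun y => posPow (-c + y) γ - posPow y γ), h2,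
      neg_zero]
  · simp
  · obtain ⟨h1, h2⟩ := posPow_add_sub_posPow_of_pos hγ hγ0 hc
    refine ⟨h1.comp_neg, ?_⟩
    simp_rw [sub_eq_add_neg c]
    rw [integral_neg_eq_self (fun y => posPow (c + y) γ - posPow y γ), h2]

end Translate

/-! ### From regularized products to increments of two powers -/

section FourPoint

variable {a b : ℝ}

/-- The subtracted term does not depend on `r` or `c`, so it will cancel in differences. To
evaluate, it is first moved to the smaller of the two points, which does not change the integral. -/
lemma integral_posPow_mul_posPow_sub (ha : -1 < a) (hb : -1 < b) (hab : -1 < a + b)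
    (hab0 : a + b < 0) (r c : ℝ) :
    Integrable (fun x => posPow (r - x) a * posPow (c - x) b - posPow (-x) (a + b)) ∧
      ∫ x, (posPow (r - x) a * posPow (c - x) b - posPow (-x) (a + b)) =
        crossPow a b (r - c) := by
  have key : ∀ a b : ℝ, -1 < a → -1 < b → -1 < a + b → a + b < 0 → ∀ r c : ℝ, c < r →
      Integrable (fun x => posPow (r - x) a * posPow (c - x) b - posPow (-x) (a + b)) ∧
      ∫ x, (posPow (r - x) a * posPow (c - x) b - posPow (-x) (a + b)) =
        crossPow a b (r - c) := by
    intro a b ha hb hab hab0 r c hrc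
    have hv := sub_pos.2 hrc
    have e : ∀ x, posPow (r - x) a * posPow (c - x) b - posPow (-x) (a + b) =
        (posPow (r - c + (c - x)) a * posPow (c - x) b - posPow (c - x) (a + b)) +
          (posPow (c - x) (a + b) - posPow (-x) (a + b)) := fun x => by
      rw [show r - c + (c - x) = r - x by ring]
      ring
    simp_rw [e]
    have i1 := (integrable_posPow_mul_sub_posPow hb hab hab0 hv).comp_sub_left c
    obtain ⟨i2, h2⟩ := posPow_sub_sub_posPow_neg hab hab0 c
    refine ⟨i1.add i2, ?_⟩
    rw [integral_add i1 i2, h2, integral_sub_left_eq_self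
      (fun y => posPow (r - c + y) a * posPow y b - posPow y (a + b)),
      integral_posPow_mul_sub_posPow ha hb hab hab0 hv, crossPow_of_pos hv, add_zero]
  rcases lt_trichotomy c r with h | rfl | h
  · exact key a b ha hb hab hab0 r c h
  · simp_rw [posPow_mul_posPow, sub_self, crossPow_zero]
    exact posPow_sub_sub_posPow_neg hab hab0 c
  · have := key b a hb ha (by linarith) (by linarith) c r h
    rw [← crossPow_neg, neg_sub] at this
    simpa only [mul_comm (posPow (c - _) b), add_comm b a] using this

/-- The integral of the product of a power and the increment of a power; the two terms of the
increment are not integrable separately. -/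
lemma integral_posPow_mul_kernelIncr (ha : -1 < a) (hb : -1 < b) (hab : -1 < a + b)
    (hab0 : a + b < 0) (r c d : ℝ) :
    Integrable (fun x => posPow (r - x) a * kernelIncr (fun y => posPow y b) c d x) ∧
      ∫ x, posPow (r - x) a * kernelIncr (fun y => posPow y b) c d x =
        crossPow a b (r - c) - crossPow a b (r - d) := by
  obtain ⟨i1, h1⟩ := integral_posPow_mul_posPow_sub ha hb hab hab0 r c
  obtain ⟨i2, h2⟩ := integral_posPow_mul_posPow_sub ha hb hab hab0 r d
  have e : ∀ x, posPow (r - x) a * kernelIncr (fun y => posPow y b) c d x =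
      (posPow (r - x) a * posPow (c - x) b - posPow (-x) (a + b)) -
        (posPow (r - x) a * posPow (d - x) b - posPow (-x) (a + b)) := fun x => by
    simp only [kernelIncr]
    ring
  simp_rw [e]
  exact ⟨i1.sub i2, by rw [integral_sub i1 i2, h1, h2]⟩

lemma hasCross_posPow_of_add_neg (ha : -1 < a) (hb : -1 < b) (hab : -1 < a + b)
    (hab0 : a + b < 0) :
    HasCross (fun y => posPow y a) (fun y => posPow y b) fun u => -crossPow a b u := by
  intro p q c d
  obtain ⟨i1, h1⟩ := integral_posPow_mul_kernelIncr ha hb hab hab0 p c d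
  obtain ⟨i2, h2⟩ := integral_posPow_mul_kernelIncr ha hb hab hab0 q c d
  have e : ∀ x, kernelIncr (fun y => posPow y a) p q x * kernelIncr (fun y => posPow y b) c d x =
      posPow (p - x) a * kernelIncr (fun y => posPow y b) c d x -
        posPow (q - x) a * kernelIncr (fun y => posPow y b) c d x := fun x => by
    simp only [kernelIncr]
    ring
  simp_rw [e]
  rw [integral_sub i1 i2, h1, h2]
  ring

lemma kernelIncr_posPow_eq_integral (ha : 0 < a) (p q x : ℝ) :
    kernelIncr (fun y => posPow y a) p q x = a * ∫ r in q..p, posPow (r - x) (a - 1) := by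
  rw [intervalIntegral.integral_comp_sub_right (fun z => posPow z (a - 1)) x,
    integral_posPow (by linarith), sub_add_cancel, mul_div_cancel₀ _ ha.ne', kernelIncr]

/-- The counterpart, for the covariance function, of raising the first exponent by integration. -/
lemma integral_crossPow (ha : 0 < a) (hab0 : 0 < a + b) (p q c : ℝ) :
    a * ∫ r in q..p, crossPow (a - 1) b (r - c) = crossPow a b (p - c) - crossPow a b (q - c) := by
  have hH : -1 < a - 1 + b + 1 := by linarith
  rw [intervalIntegral.integral_comp_sub_right (fun z => crossPow (a - 1) b z) c]
  unfold crossPow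
  have i2 : ∀ p q : ℝ, IntervalIntegrable (fun z => posPow (-z) (a - 1 + b + 1)) volume p q := by
    intro p q
    have := (intervalIntegrable_posPow hH (-p) (-q)).comp_mul_left (c := -1)
    simpa using this
  rw [intervalIntegral.integral_add ((intervalIntegrable_posPow hH _ _).const_mul _)
    ((i2 _ _).const_mul _), intervalIntegral.integral_const_mul,
    intervalIntegral.integral_const_mul,
    intervalIntegral.integral_comp_neg (fun z => posPow z (a - 1 + b + 1)), integral_posPow hH,
    integral_posPow hH, show a - 1 + b + 1 + 1 = a + b + 1 by ring]
  have e1 : a * crossCoeff (a - 1) b = (a + b + 1) * crossCoeff a b := by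
    unfold crossCoeff
    rw [show Real.pi * (a - 1) = Real.pi * a - Real.pi by ring, Real.sin_sub_pi,
      show Real.pi * (a - 1 + b + 1) = Real.pi * (a + b + 1) - Real.pi by ring, Real.sin_sub_pi,
      sub_add_cancel, Real.Gamma_add_one ha.ne', show a - 1 + b + 2 = a + b + 1 by ring,
      show a + b + 2 = a + b + 1 + 1 by ring, Real.Gamma_add_one (show a + b + 1 ≠ 0 by linarith),
      neg_mul, mul_neg, neg_div_neg_eq]
    have := Real.Gamma_pos_of_pos (show 0 < a + b + 1 by linarith)
    have : a + b + 1 ≠ 0 := by linarith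
    field_simp
  -- The sign differs from `e1`: shifting `a` by one flips only the sine in the denominator here,
  -- but both sines there. It matches the sign from integrating a power of `-z`.
  have e2 : a * crossCoeff b (a - 1) = -((a + b + 1) * crossCoeff b a) := by
    unfold crossCoeff
    rw [show Real.pi * (b + (a - 1) + 1) = Real.pi * (b + a + 1) - Real.pi by ring,
      Real.sin_sub_pi,
      sub_add_cancel, Real.Gamma_add_one ha.ne', show b + (a - 1) + 2 = a + b + 1 by ring,
      show b + a + 2 = a + b + 1 + 1 by ring, Real.Gamma_add_one (show a + b + 1 ≠ 0 by linarith)]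
    have := Real.Gamma_pos_of_pos (show 0 < a + b + 1 by linarith)
    have : a + b + 1 ≠ 0 := by linarith
    field_simp
  have hne : a + b + 1 ≠ 0 := by linarith
  field_simp
  linear_combination (posPow (p - c) (a + b + 1) - posPow (q - c) (a + b + 1)) * e1 +
    (posPow (-(q - c)) (a + b + 1) - posPow (-(p - c)) (a + b + 1)) * e2

/-- The first increment is an integral of powers with exponent `a - 1`, and the pair `(a - 1, b)`
has sum in `(-1, 0)`, where the products with increments of the second power are already evaluated.
-/
lemma hasCross_posPow_of_add_pos (ha : 0 < a) (ha2 : a < 1 / 2) (hb : -(1 / 2) < b)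
    (hb2 : b < 1 / 2) (hab0 : 0 < a + b) :
    HasCross (fun y => posPow y a) (fun y => posPow y b) fun u => -crossPow a b u := by
  intro p q c d
  set D := kernelIncr (fun y => posPow y b) c d with hD
  have hDm : Measurable D := by
    rw [hD]
    unfold kernelIncr
    fun_prop
  have hi : ∀ x, IntervalIntegrable (fun r => posPow (r - x) (a - 1)) volume q p := fun x => by
    have := (intervalIntegrable_posPow (show -1 < a - 1 by linarith) (q - x) (p - x)).comp_sub_right
      x
    simpa using this
  have hswap : Integrable (Function.uncurry fun r x => posPow (r - x) (a - 1) * D x)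
      ((volume.restrict (Set.uIoc q p)).prod volume) := by
    have hm : Measurable (Function.uncurry fun r x => posPow (r - x) (a - 1) * D x) :=
      ((measurable_posPow (a - 1)).comp (measurable_fst.sub measurable_snd)).mul
        (hDm.comp measurable_snd)
    rw [integrable_prod_iff' hm.aestronglyMeasurable]
    refine ⟨ae_of_all _ fun x => ?_, ?_⟩
    · exact (intervalIntegrable_iff.1 (hi x)).mul_const (D x)
    -- The powers are nonnegative, so integrating the absolute value over `r` recovers `a⁻¹` times
    -- the modulus of a product of two square integrable increments.
    have := (integrable_mul_of_memLp_two (sqIntegrableIncr_posPow (α := a) (by linarith) ha2 p q)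
      (sqIntegrableIncr_posPow hb hb2 c d)).norm.const_mul a⁻¹
    refine this.congr (ae_of_all _ fun x => ?_)
    have e : ∀ r, ‖posPow (r - x) (a - 1) * D x‖ = posPow (r - x) (a - 1) * |D x| := fun r => by
      rw [norm_mul, Real.norm_of_nonneg (posPow_nonneg _ _), Real.norm_eq_abs]
    simp only [Function.uncurry_apply_pair, e]
    rw [integral_mul_const, norm_mul, kernelIncr_posPow_eq_integral ha, norm_mul,
      Real.norm_of_nonneg ha.le, Real.norm_eq_abs, intervalIntegral.abs_intervalIntegral_eq,
      abs_of_nonneg (integral_nonneg fun r => posPow_nonneg _ _), Real.norm_eq_abs, hD]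
    field_simp
  have hswap' := intervalIntegral_integral_swap hswap
  have hcross : ∀ c, IntervalIntegrable (fun r => crossPow (a - 1) b (r - c)) volume q p := by
    intro c
    have hH : -1 < a - 1 + b + 1 := by linarith
    have h1 := (intervalIntegrable_posPow hH (q - c) (p - c)).comp_sub_right c
    have h2 := (intervalIntegrable_posPow hH (c - q) (c - p)).comp_sub_left c
    simp only [sub_add_cancel, sub_sub_cancel] at h1 h2
    unfold crossPow
    refine (h1.const_mul _).add (IntervalIntegrable.const_mul ?_ _)
    simpa only [neg_sub] using h2
  calc ∫ x, kernelIncr (fun y => posPow y a) p q x * D x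
      = a * ∫ x, ∫ r in q..p, posPow (r - x) (a - 1) * D x := by
        rw [← integral_const_mul]
        congr 1 with x
        rw [intervalIntegral.integral_mul_const, kernelIncr_posPow_eq_integral ha]
        ring
    _ = a * ∫ r in q..p, (crossPow (a - 1) b (r - c) - crossPow (a - 1) b (r - d)) := by
        rw [← hswap']
        congr 1
        refine intervalIntegral.integral_congr fun r _ => ?_
        exact (integral_posPow_mul_kernelIncr (by linarith) (by linarith) (by linarith)
          (by linarith) r c d).2
    _ = _ := by
        rw [intervalIntegral.integral_sub (hcross c) (hcross d), mul_sub,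
          integral_crossPow ha hab0, integral_crossPow ha hab0]
        ring

/-- Cross-covariances of two causal power kernels. -/
lemma hasCross_posPow_posPow (ha : -(1 / 2) < a) (ha2 : a < 1 / 2) (hb : -(1 / 2) < b)
    (hb2 : b < 1 / 2) (hab0 : a + b ≠ 0) :
    HasCross (fun y => posPow y a) (fun y => posPow y b) fun u => -crossPow a b u := by
  rcases lt_or_gt_of_ne hab0 with h | h
  · exact hasCross_posPow_of_add_neg (by linarith) (by linarith) (by linarith) h
  · rcases lt_or_ge 0 a with ha0 | ha0
    · exact hasCross_posPow_of_add_pos ha0 ha2 hb hb2 h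
    · refine (hasCross_posPow_of_add_pos (a := b) (b := a) (by linarith) hb2 ha ha2
        (by linarith)).swap.congr fun u => ?_
      rw [crossPow_neg]

end FourPoint

/-! ### Cross-covariances of opposite one-sided powers -/

section Opposite

variable {a b : ℝ}

lemma posPow_mul_posPow_one_sub (ha : -1 < a) (hb : -1 < b) :
    (fun x => posPow (1 - x) a * posPow x b) =
      fun x => beta (b + 1) (a + 1) * betaPDFReal (b + 1) (a + 1) x := by
  have := (beta_pos (show 0 < b + 1 by linarith) (show 0 < a + 1 by linarith)).ne'
  ext x
  unfold betaPDFReal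
  split_ifs with h
  · rw [posPow_of_pos (by linarith), posPow_of_pos h.1, add_sub_cancel_right, add_sub_cancel_right]
    field_simp
  · rw [not_and_or, not_lt, not_lt] at h
    rcases h with h | h
    · rw [posPow_of_nonpos h, mul_zero, mul_zero]
    · rw [posPow_of_nonpos (show 1 - x ≤ 0 by linarith), zero_mul, mul_zero]

/-- Up to normalization the integrand is the Beta density, whose total mass is one. -/
lemma integral_posPow_mul_posPow_one_sub (ha : -1 < a) (hb : -1 < b) :
    Integrable (fun x => posPow (1 - x) a * posPow x b) ∧
      ∫ x, posPow (1 - x) a * posPow x b = beta (b + 1) (a + 1) := by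
  have h1 := lintegral_betaPDF_eq_one (show 0 < b + 1 by linarith) (show 0 < a + 1 by linarith)
  have hnn : 0 ≤ᵐ[volume] betaPDFReal (b + 1) (a + 1) := ae_of_all _ fun x => by
    by_cases h : 0 < x ∧ x < 1
    · exact (betaPDFReal_pos h.1 h.2 (by linarith) (by linarith)).le
    · simp [betaPDFReal, h]
  have hm := (measurable_betaPDFReal (b + 1) (a + 1)).aestronglyMeasurable (μ := volume)
  have hi : Integrable (betaPDFReal (b + 1) (a + 1)) := by
    refine ⟨hm, ?_⟩
    rw [hasFiniteIntegral_iff_ofReal hnn]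
    exact h1.trans_lt ENNReal.one_lt_top
  rw [posPow_mul_posPow_one_sub ha hb]
  refine ⟨hi.const_mul _, ?_⟩
  rw [integral_const_mul, integral_eq_lintegral_of_nonneg_ae hnn hm]
  have : ∫⁻ x, ENNReal.ofReal (betaPDFReal (b + 1) (a + 1) x) = 1 := h1
  rw [this, ENNReal.toReal_one, mul_one]

/-- The two factors overlap only between `c` and `r`; an affine substitution maps that interval to
the unit interval. No regularization is needed. -/
lemma integral_posPow_sub_mul_posPow_sub (ha : -1 < a) (hb : -1 < b) (r c : ℝ) :
    Integrable (fun x => posPow (r - x) a * posPow (-(c - x)) b) ∧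
      ∫ x, posPow (r - x) a * posPow (-(c - x)) b =
        beta (b + 1) (a + 1) * posPow (r - c) (a + b + 1) := by
  rcases lt_or_ge c r with h | h
  · have hv := sub_pos.2 h
    set v := r - c with hvdef
    obtain ⟨i1, h1⟩ := integral_posPow_mul_posPow_one_sub ha hb
    have e : ∀ x, posPow (r - x) a * posPow (-(c - x)) b =
        v ^ (a + b) * (posPow (1 - (x - c) / v) a * posPow ((x - c) / v) b) := by
      have scale : ∀ z γ : ℝ, posPow (v * z) γ = v ^ γ * posPow z γ := by
        intro z γ
        rcases lt_or_ge 0 z with hz | hz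
        · rw [posPow_of_pos hz, posPow_of_pos (by positivity), Real.mul_rpow hv.le hz.le]
        · rw [posPow_of_nonpos hz, posPow_of_nonpos (mul_nonpos_of_nonneg_of_nonpos hv.le hz),
            mul_zero]
      intro x
      have e1 : r - x = v * (1 - (x - c) / v) := by
        rw [mul_sub, mul_div_cancel₀ _ hv.ne']
        simp [hvdef]
      have e2 : -(c - x) = v * ((x - c) / v) := by
        rw [mul_div_cancel₀ _ hv.ne']
        ring
      rw [e1, e2, scale, scale, Real.rpow_add hv]
      ring
    simp_rw [e]
    refine ⟨((i1.comp_div hv.ne').comp_sub_right c).const_mul _, ?_⟩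
    rw [integral_const_mul,
      integral_sub_right_eq_self (fun x => posPow (1 - x / v) a * posPow (x / v) b) c,
      Measure.integral_comp_div (fun z => posPow (1 - z) a * posPow z b) v, h1, posPow_of_pos hv,
      Real.rpow_add hv (a + b) 1, Real.rpow_one, abs_of_pos hv, smul_eq_mul]
    ring
  · have e : ∀ x, posPow (r - x) a * posPow (-(c - x)) b = 0 := by
      intro x
      rcases le_total x c with hx | hx
      · rw [posPow_of_nonpos (show -(c - x) ≤ 0 by linarith), mul_zero]
      · rw [posPow_of_nonpos (show r - x ≤ 0 by linarith), zero_mul]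
    simp_rw [e]
    rw [posPow_of_nonpos (show r - c ≤ 0 by linarith)]
    simp

/-- Cross-covariances of a causal and an anticausal power kernel. -/
lemma hasCross_posPow_posPow_neg (ha : -1 < a) (hb : -1 < b) :
    HasCross (fun y => posPow y a) (fun y => posPow (-y) b)
      fun u => -(beta (b + 1) (a + 1) * posPow u (a + b + 1)) := by
  intro p q c d
  have i := fun r c => (integral_posPow_sub_mul_posPow_sub ha hb r c).1
  have h := fun r c => (integral_posPow_sub_mul_posPow_sub ha hb r c).2
  have i' : ∀ r, Integrable fun x => posPow (r - x) a * posPow (-(c - x)) b -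
      posPow (r - x) a * posPow (-(d - x)) b := fun r => (i r c).sub (i r d)
  have e : ∀ x, kernelIncr (fun y => posPow y a) p q x *
      kernelIncr (fun y => posPow (-y) b) c d x =
      (posPow (p - x) a * posPow (-(c - x)) b - posPow (p - x) a * posPow (-(d - x)) b) -
        (posPow (q - x) a * posPow (-(c - x)) b - posPow (q - x) a * posPow (-(d - x)) b) :=
    fun x => by
      simp only [kernelIncr]
      ring
  simp_rw [e]
  rw [integral_sub (i' p) (i' q), integral_sub (i p c) (i p d), integral_sub (i q c) (i q d),
    h, h, h, h]
  ring

end Opposite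

/-! ### Normalized symmetric powers -/

/-- `(|y| ^ α - 1) / α`, continuously extended to `α = 0`. -/
noncomputable def boxCox (α y : ℝ) : ℝ :=
  if α = 0 then Real.log |y| else (posPow y α + posPow (-y) α - 1) / α

/-- `sin (π α / 2) / α`, continuously extended to `α = 0`. -/
noncomputable def sinRatio (α : ℝ) : ℝ := Real.pi / 2 * Real.sinc (Real.pi * α / 2)

lemma posPow_add_posPow_neg {y : ℝ} (hy : y ≠ 0) (α : ℝ) :
    posPow y α + posPow (-y) α = |y| ^ α := by
  rcases lt_or_gt_of_ne hy with h | h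
  · rw [posPow_of_nonpos h.le, posPow_of_pos (by linarith), zero_add, abs_of_neg h]
  · rw [posPow_of_pos h, posPow_of_nonpos (by linarith), add_zero, abs_of_pos h]

lemma posPow_add_posPow_neg_of_ne_zero {γ : ℝ} (hγ : γ ≠ 0) (u : ℝ) :
    posPow u γ + posPow (-u) γ = |u| ^ γ := by
  rcases eq_or_ne u 0 with rfl | hu
  · simp [posPow, Real.zero_rpow hγ]
  · exact posPow_add_posPow_neg hu γ

lemma boxCox_abs (α y : ℝ) : boxCox α |y| = boxCox α y := by
  unfold boxCox
  rw [abs_abs]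
  rcases abs_cases y with ⟨h, _⟩ | ⟨h, _⟩
  · rw [h]
  · rw [h, neg_neg, add_comm (posPow (-y) α)]

lemma boxCox_of_ne_zero {α : ℝ} (hα : α ≠ 0) (y : ℝ) :
    boxCox α y = α⁻¹ * (posPow y α + posPow (-y) α) - α⁻¹ := by
  rw [boxCox, if_neg hα]
  ring

@[fun_prop]
lemma measurable_boxCox (α : ℝ) : Measurable fun y => boxCox α y := by
  by_cases hα : α = 0
  · simp only [boxCox, if_pos hα]
    fun_prop
  · simp only [boxCox, if_neg hα]
    have h := measurable_posPow α
    exact ((h.add (h.comp measurable_neg)).sub_const 1).div_const α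

/-- One integral representation covers powers and the logarithm alike, which makes comparison in `α`
uniform through `0`. -/
lemma boxCox_sub_boxCox (α : ℝ) {y z : ℝ} (hy : 0 < y) (hz : 0 < z) :
    boxCox α y - boxCox α z = ∫ r in z..y, r ^ (α - 1) := by
  have h0 : (0 : ℝ) ∉ Set.uIcc z y := fun h => by
    rw [Set.mem_uIcc] at h
    rcases h with h | h <;> linarith
  by_cases hα : α = 0
  · subst hα
    simp only [boxCox, if_true, zero_sub, Real.rpow_neg_one]
    rw [integral_inv h0, abs_of_pos hy, abs_of_pos hz, Real.log_div hy.ne' hz.ne']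
  · rw [integral_rpow (Or.inr ⟨by contrapose! hα; linarith, h0⟩), boxCox_of_ne_zero hα,
      boxCox_of_ne_zero hα, posPow_add_posPow_neg hy.ne', posPow_add_posPow_neg hz.ne',
      abs_of_pos hy, abs_of_pos hz, sub_add_cancel]
    ring

lemma rpow_le_rpow_add_rpow_neg {α p : ℝ} (hα : |α| ≤ p) {r : ℝ} (hr : 0 < r) :
    r ^ α ≤ r ^ p + r ^ (-p) := by
  obtain ⟨h1, h2⟩ := abs_le.1 hα
  rcases le_total 1 r with h | h
  · linarith [Real.rpow_le_rpow_of_exponent_le h h2, Real.rpow_nonneg hr.le (-p)]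
  · linarith [Real.rpow_le_rpow_of_exponent_ge hr h h1, Real.rpow_nonneg hr.le p]

/-- The densities satisfy `r ^ (α - 1) ≤ r ^ (p - 1) + r ^ (-p - 1)`, and an increment is the
integral of its density between the absolute values. -/
lemma abs_boxCox_sub_boxCox_le {α p : ℝ} (hα : |α| ≤ p) {y z : ℝ} (hy : y ≠ 0) (hz : z ≠ 0) :
    |boxCox α y - boxCox α z| ≤
      |boxCox p y - boxCox p z| + |boxCox (-p) y - boxCox (-p) z| := by
  have key : ∀ y z : ℝ, 0 < z → z ≤ y → |boxCox α y - boxCox α z| ≤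
      |boxCox p y - boxCox p z| + |boxCox (-p) y - boxCox (-p) z| := by
    intro y z hz hzy
    have hy : 0 < y := hz.trans_le hzy
    have hint : ∀ γ : ℝ, IntervalIntegrable (fun r : ℝ => r ^ γ) volume z y := fun γ =>
      intervalIntegral.intervalIntegrable_rpow (Or.inr fun h => by
        rw [Set.uIcc_of_le hzy] at h
        linarith [h.1])
    have hnn : ∀ γ : ℝ, 0 ≤ ∫ r in z..y, r ^ γ := fun γ =>
      intervalIntegral.integral_nonneg hzy fun r hr => Real.rpow_nonneg (hz.le.trans hr.1) γ
    rw [boxCox_sub_boxCox α hy hz, boxCox_sub_boxCox p hy hz, boxCox_sub_boxCox (-p) hy hz,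
      abs_of_nonneg (hnn _), abs_of_nonneg (hnn _), abs_of_nonneg (hnn _),
      ← intervalIntegral.integral_add (hint _) (hint _)]
    refine intervalIntegral.integral_mono_on hzy (hint _) ((hint _).add (hint _)) fun r hr => ?_
    have hr0 : 0 < r := hz.trans_le hr.1
    rw [Real.rpow_sub_one hr0.ne', Real.rpow_sub_one hr0.ne', Real.rpow_sub_one hr0.ne',
      ← add_div]
    gcongr
    exact rpow_le_rpow_add_rpow_neg hα hr0
  rw [← boxCox_abs α y, ← boxCox_abs α z, ← boxCox_abs p y, ← boxCox_abs p z,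
    ← boxCox_abs (-p) y, ← boxCox_abs (-p) z]
  rcases le_total |z| |y| with h | h
  · exact key _ _ (abs_pos.2 hz) h
  · rw [abs_sub_comm (boxCox α _), abs_sub_comm (boxCox p _), abs_sub_comm (boxCox (-p) _)]
    exact key _ _ (abs_pos.2 hy) h

lemma eventually_nhdsNE_ne (a x : ℝ) : ∀ᶠ α in 𝓝[≠] a, α ≠ x :=
  (eventually_cofinite_ne x).filter_mono (nhdsNE_le_cofinite a)

lemma continuousAt_boxCox (a : ℝ) {y : ℝ} (hy : y ≠ 0) :
    ContinuousAt (fun α => boxCox α y) a := by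
  have hy' : |y| ≠ 0 := abs_ne_zero.2 hy
  rw [← continuousWithinAt_compl_self]
  by_cases ha : a = 0
  · subst ha
    -- At `α = 0` the quotient is a difference quotient of `α ↦ |y| ^ α`, whose derivative there is
    -- the logarithm.
    have h : HasDerivAt (fun α : ℝ => |y| ^ α) (Real.log |y|) 0 := by
      simpa using (Real.hasStrictDerivAt_const_rpow (abs_pos.2 hy) 0).hasDerivAt
    have hs := hasDerivAt_iff_tendsto_slope.1 h
    have h0 : boxCox 0 y = Real.log |y| := if_pos rfl
    rw [ContinuousWithinAt, h0]
    refine hs.congr' ?_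
    filter_upwards [eventually_nhdsNE_ne 0 0] with α hα
    rw [boxCox_of_ne_zero hα, posPow_add_posPow_neg hy, slope_def_field, sub_zero, Real.rpow_zero]
    ring
  · have h : ContinuousAt (fun α => α⁻¹ * |y| ^ α - α⁻¹) a :=
      ((continuousAt_inv₀ ha).mul (continuousAt_const.rpow continuousAt_id (Or.inl hy'))).sub
        (continuousAt_inv₀ ha)
    refine (h.congr ?_).continuousWithinAt
    filter_upwards [isOpen_ne.mem_nhds ha] with α hα
    rw [boxCox_of_ne_zero hα, posPow_add_posPow_neg hy]

lemma continuous_sinRatio : Continuous sinRatio := by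
  unfold sinRatio
  have := Real.continuous_sinc
  fun_prop

lemma sinRatio_mul (α : ℝ) : sinRatio α * α = Real.sin (Real.pi * α / 2) := by
  unfold sinRatio
  rcases eq_or_ne α 0 with rfl | h
  · simp
  · have := Real.pi_pos.ne'
    rw [Real.sinc_of_ne_zero (by positivity)]
    field_simp

lemma sinRatio_neg (α : ℝ) : sinRatio (-α) = sinRatio α := by
  unfold sinRatio
  rw [mul_neg, neg_div, Real.sinc_neg]

lemma sinRatio_pos {α : ℝ} (h1 : -1 < α) (h2 : α < 1) : 0 < sinRatio α := by
  have key : ∀ α : ℝ, 0 < α → α < 1 → 0 < sinRatio α := by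
    intro α h0 h1
    have : 0 < sinRatio α * α := by
      rw [sinRatio_mul]
      exact Real.sin_pos_of_pos_of_lt_pi (by positivity) (by nlinarith [Real.pi_pos])
    exact pos_of_mul_pos_left this h0.le
  rcases lt_trichotomy α 0 with h | rfl | h
  · rw [← sinRatio_neg]
    exact key _ (by linarith) (by linarith)
  · simp [sinRatio, Real.pi_pos]
  · exact key _ h h2

/-! ### Translation of kernels by constants -/

lemma HasCross.sub_const_left {g h V : ℝ → ℝ} (hV : HasCross g h V) (m : ℝ) :
    HasCross (fun y => g y - m) h V := by
  intro a b c d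
  rw [← hV a b c d]
  congr 1 with x
  simp [kernelIncr]

lemma HasCross.sub_const_right {g h V : ℝ → ℝ} (hV : HasCross g h V) (m : ℝ) :
    HasCross g (fun y => h y - m) V :=
  (hV.swap.sub_const_left m).swap.congr fun u => by simp

lemma SqIntegrableIncr.sub_const {g : ℝ → ℝ} (hg : SqIntegrableIncr g) (m : ℝ) :
    SqIntegrableIncr fun y => g y - m := fun a b => by
  convert hg a b using 1
  ext x
  simp [kernelIncr]

lemma sqIntegrableIncr_boxCox_of_ne_zero {α : ℝ} (h1 : -(1 / 2) < α) (h2 : α < 1 / 2)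
    (hα : α ≠ 0) : SqIntegrableIncr (boxCox α) := by
  have h := sqIntegrableIncr_posPow h1 h2
  rw [funext (boxCox_of_ne_zero hα)]
  exact ((h.add h.comp_neg).const_mul _).sub_const _

lemma exists_dominating_boxCox {p : ℝ} (hp : 0 < p) (hp2 : p < 1 / 2) (s t : ℝ) :
    ∃ F : ℝ → ℝ, MemLp F 2 volume ∧
      ∀ α, |α| ≤ p → ∀ᵐ x, |kernelIncr (boxCox α) s t x| ≤ F x := by
  refine ⟨_, ((sqIntegrableIncr_boxCox_of_ne_zero (by linarith) hp2 hp.ne' s t).abs).add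
    ((sqIntegrableIncr_boxCox_of_ne_zero (α := -p) (by linarith) (by linarith) (by linarith)
      s t).abs), fun α hα => ?_⟩
  filter_upwards [Measure.ae_ne volume s, Measure.ae_ne volume t] with x hxs hxt
  exact abs_boxCox_sub_boxCox_le hα (sub_ne_zero.2 hxs.symm) (sub_ne_zero.2 hxt.symm)

/-- Domination by the exponents `p` and `-p`, both nonzero, includes the logarithm. -/
lemma sqIntegrableIncr_boxCox {α : ℝ} (h1 : -(1 / 2) < α) (h2 : α < 1 / 2) :
    SqIntegrableIncr (boxCox α) := by
  intro s t
  obtain ⟨p, hp1, hp2⟩ := exists_between (abs_lt.2 ⟨h1, h2⟩)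
  obtain ⟨F, hF, hb⟩ := exists_dominating_boxCox ((abs_nonneg α).trans_lt hp1) hp2 s t
  refine hF.mono' ?_ (hb α hp1.le)
  have := measurable_boxCox α
  unfold kernelIncr
  fun_prop

lemma eventually_abs_le {a p : ℝ} (h : |a| < p) : ∀ᶠ α in 𝓝[≠] a, |α| ≤ p :=
  ((continuous_abs.continuousAt.eventually_lt continuousAt_const h).mono fun _ h => h.le).filter_mono
    nhdsWithin_le_nhds

/-- A punctured neighborhood suffices, so isolated exceptional exponents can be filled in by
continuity. -/
lemma HasCross.of_boxCox_nhdsNE {a : ℝ} {h : ℝ → ℝ} {V : ℝ → ℝ → ℝ} (h1 : -(1 / 2) < a)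
    (h2 : a < 1 / 2) (hh : SqIntegrableIncr h)
    (hV : ∀ᶠ α in 𝓝[≠] a, HasCross (boxCox α) h (V α))
    (hlim : ∀ u, ContinuousAt (fun α => V α u) a) : HasCross (boxCox a) h (V a) := by
  obtain ⟨p, hp1, hp2⟩ := exists_between (abs_lt.2 ⟨h1, h2⟩)
  refine HasCross.of_tendsto hh hV measurable_boxCox (fun s t => ?_) ?_
    fun u => (hlim u).tendsto.mono_left nhdsWithin_le_nhds
  · obtain ⟨F, hF, hb⟩ := exists_dominating_boxCox ((abs_nonneg a).trans_lt hp1) hp2 s t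
    exact ⟨F, hF, (eventually_abs_le hp1).mono hb⟩
  · filter_upwards [Measure.ae_ne volume 0] with y hy
    exact (continuousAt_boxCox a hy).tendsto.mono_left nhdsWithin_le_nhds

/-! ### Cross-covariances for all exponents -/

lemma continuousAt_Gamma_of_pos {x : ℝ} (hx : 0 < x) : ContinuousAt Real.Gamma x :=
  (Real.differentiableAt_Gamma fun m => by
    have : (0 : ℝ) ≤ m := m.cast_nonneg
    linarith).continuousAt

section Balanced

variable {a b : ℝ}

/-- The coefficient of `|u| ^ (a + b + 1)` in the cross-covariance of well-balanced kernels. -/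
noncomputable def balancedCoeff (a b : ℝ) : ℝ :=
  2 * Real.Gamma (a + 1) * Real.Gamma (b + 1) * sinRatio a * sinRatio b /
    (Real.Gamma (a + b + 2) * Real.sin (Real.pi * (a + b + 1) / 2))

lemma balancedCoeff_comm (a b : ℝ) : balancedCoeff a b = balancedCoeff b a := by
  unfold balancedCoeff
  rw [add_comm b a]
  ring

lemma sin_two_mul_add_sin_two_mul (p q : ℝ) :
    Real.sin (2 * p) + Real.sin (2 * q) =
      2 * Real.sin (p + q) * (Real.cos (p + q) + 2 * Real.sin p * Real.sin q) := by
  rw [Real.sin_two_mul, Real.sin_two_mul, Real.sin_add, Real.cos_add]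
  linear_combination -(2 * Real.sin p * Real.cos p) * Real.sin_sq_add_cos_sq q -
    2 * Real.sin q * Real.cos q * Real.sin_sq_add_cos_sq p

lemma cos_half_pi_mul_pos {x : ℝ} (h1 : -1 < x) (h2 : x < 1) : 0 < Real.cos (Real.pi * x / 2) :=
  Real.cos_pos_of_mem_Ioo ⟨by nlinarith [Real.pi_pos], by nlinarith [Real.pi_pos]⟩

lemma sin_half_pi_mul_ne_zero {x : ℝ} (h1 : -1 < x) (h2 : x < 1) (h0 : x ≠ 0) :
    Real.sin (Real.pi * x / 2) ≠ 0 := by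
  rw [← sinRatio_mul]
  exact mul_ne_zero (sinRatio_pos h1 h2).ne' h0

lemma sin_half_pi_mul_add_one (x : ℝ) :
    Real.sin (Real.pi * (x + 1) / 2) = Real.cos (Real.pi * x / 2) := by
  rw [show Real.pi * (x + 1) / 2 = Real.pi * x / 2 + Real.pi / 2 by ring, Real.sin_add_pi_div_two]

lemma sin_pi_mul_add_one (x : ℝ) : Real.sin (Real.pi * (x + 1)) =
    -(2 * Real.sin (Real.pi * x / 2) * Real.cos (Real.pi * x / 2)) := by
  rw [show Real.pi * (x + 1) = 2 * (Real.pi * x / 2) + Real.pi by ring, Real.sin_add_pi,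
    Real.sin_two_mul]

/-- The two causal coefficients and the Beta function share the Gamma factors; what remains is the
identity for `sin (2 * p) + sin (2 * q)` at `p = π a / 2`, `q = π b / 2`. -/
lemma balancedCoeff_mul (h1 : -1 < a + b) (h2 : a + b < 1) (h0 : a + b ≠ 0) :
    -(crossCoeff a b + crossCoeff b a + beta (b + 1) (a + 1)) = balancedCoeff a b * (a * b) := by
  have hc := (cos_half_pi_mul_pos h1 h2).ne'
  have hs := sin_half_pi_mul_ne_zero h1 h2 h0
  have hG := (Real.Gamma_pos_of_pos (show 0 < a + b + 2 by linarith)).ne'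
  have e : balancedCoeff a b * (a * b) = 2 * Real.Gamma (a + 1) * Real.Gamma (b + 1) *
      (sinRatio a * a) * (sinRatio b * b) /
      (Real.Gamma (a + b + 2) * Real.sin (Real.pi * (a + b + 1) / 2)) := by
    unfold balancedCoeff
    ring
  have key := sin_two_mul_add_sin_two_mul (Real.pi * a / 2) (Real.pi * b / 2)
  rw [show 2 * (Real.pi * a / 2) = Real.pi * a by ring,
    show 2 * (Real.pi * b / 2) = Real.pi * b by ring,
    show Real.pi * a / 2 + Real.pi * b / 2 = Real.pi * (a + b) / 2 by ring] at key
  rw [e, sinRatio_mul, sinRatio_mul, crossCoeff, crossCoeff, beta, add_comm b a,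
    show b + 1 + (a + 1) = a + b + 2 by ring, sin_half_pi_mul_add_one, sin_pi_mul_add_one]
  generalize Real.sin (Real.pi * a) = s1 at *
  generalize Real.sin (Real.pi * b) = s2 at *
  generalize Real.sin (Real.pi * (a + b) / 2) = s3 at *
  generalize Real.cos (Real.pi * (a + b) / 2) = c3 at *
  generalize Real.sin (Real.pi * a / 2) = s4 at *
  generalize Real.sin (Real.pi * b / 2) = s5 at *
  field_simp
  linear_combination Real.Gamma (a + 1) * Real.Gamma (b + 1) * key

/-- The pairing expands bilinearly into causal and anticausal parts, the latter two being
reflections of the former; the constants in `boxCox` drop out of increments. -/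
lemma hasCross_boxCox_of_ne_zero (ha : -(1 / 2) < a) (ha2 : a < 1 / 2) (hb : -(1 / 2) < b)
    (hb2 : b < 1 / 2) (ha0 : a ≠ 0) (hb0 : b ≠ 0) (hab0 : a + b ≠ 0) :
    HasCross (boxCox a) (boxCox b) fun u => balancedCoeff a b * |u| ^ (a + b + 1) := by
  have sa := sqIntegrableIncr_posPow ha ha2
  have sb := sqIntegrableIncr_posPow hb hb2
  have pp := hasCross_posPow_posPow ha ha2 hb hb2 hab0
  have pn := hasCross_posPow_posPow_neg (a := a) (b := b) (by linarith) (by linarith)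
  have np := pn.comp_neg
  simp only [neg_neg] at np
  have h := (((HasCross.add_right sb sb.comp_neg sa pp pn).add_left sa sa.comp_neg
    (sb.add sb.comp_neg) (HasCross.add_right sb sb.comp_neg sa.comp_neg np
      pp.comp_neg)).const_mul_left a⁻¹).const_mul_right b⁻¹
  rw [funext (boxCox_of_ne_zero ha0), funext (boxCox_of_ne_zero hb0)]
  refine ((h.sub_const_left a⁻¹).sub_const_right b⁻¹).congr fun u => ?_
  have key := balancedCoeff_mul (a := a) (b := b) (by linarith) (by linarith) hab0
  rw [← posPow_add_posPow_neg_of_ne_zero (show a + b + 1 ≠ 0 by linarith), crossPow, crossPow,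
    neg_neg]
  field_simp
  linear_combination (posPow u (a + b + 1) + posPow (-u) (a + b + 1)) * key

lemma continuousAt_balancedCoeff_mul_rpow (ha : -(1 / 2) < a) (hb : -(1 / 2) < b)
    (ha2 : a < 1 / 2) (hb2 : b < 1 / 2) (u : ℝ) :
    ContinuousAt (fun α => balancedCoeff α b * |u| ^ (α + b + 1)) a := by
  have g1 : ContinuousAt (fun α => Real.Gamma (α + 1)) a :=
    ContinuousAt.comp (f := fun α => α + 1) (continuousAt_Gamma_of_pos (by linarith)) (by fun_prop)
  have g2 : ContinuousAt (fun α => Real.Gamma (α + b + 2)) a :=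
    ContinuousAt.comp (f := fun α => α + b + 2) (continuousAt_Gamma_of_pos (by linarith)) (by fun_prop)
  have hs := continuous_sinRatio.continuousAt (x := a)
  have hr : ContinuousAt (fun α => |u| ^ (α + b + 1)) a :=
    continuousAt_const.rpow (by fun_prop) (Or.inr (by linarith))
  have hG2 := (Real.Gamma_pos_of_pos (show 0 < a + b + 2 by linarith)).ne'
  have hc := (cos_half_pi_mul_pos (x := a + b) (by linarith) (by linarith)).ne'
  rw [← sin_half_pi_mul_add_one] at hc
  unfold balancedCoeff
  fun_prop (disch := positivity)

/-- Cross-covariances of two well-balanced power kernels, including the logarithmic one. -/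
theorem hasCross_boxCox (ha : -(1 / 2) < a) (ha2 : a < 1 / 2) (hb : -(1 / 2) < b)
    (hb2 : b < 1 / 2) :
    HasCross (boxCox a) (boxCox b) fun u => balancedCoeff a b * |u| ^ (a + b + 1) := by
  have mem : ∀ x : ℝ, -(1 / 2) < x → x < 1 / 2 → ∀ᶠ α in 𝓝[≠] x, -(1 / 2) < α ∧ α < 1 / 2 :=
    fun x h1 h2 => mem_nhdsWithin_of_mem_nhds (Ioo_mem_nhds h1 h2)
  -- The exponents `a = 0` and `a + b = 0` are reached by moving `a` with `b ≠ 0` fixed; afterwards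
  -- `b` is moved, which also gives `b = 0`.
  have step : ∀ b : ℝ, -(1 / 2) < b → b < 1 / 2 → b ≠ 0 →
      HasCross (boxCox a) (boxCox b) fun u => balancedCoeff a b * |u| ^ (a + b + 1) := by
    intro b hb hb2 hb0
    refine HasCross.of_boxCox_nhdsNE
      (V := fun α u => balancedCoeff α b * |u| ^ (α + b + 1)) ha ha2 (sqIntegrableIncr_boxCox hb hb2)
      ?_ (continuousAt_balancedCoeff_mul_rpow ha hb ha2 hb2)
    filter_upwards [mem a ha ha2, eventually_nhdsNE_ne a 0, eventually_nhdsNE_ne a (-b)]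
      with α h1 h2 h3
    exact hasCross_boxCox_of_ne_zero h1.1 h1.2 hb hb2 h2 hb0 fun h => h3 (by linarith)
  have hswap : HasCross (boxCox b) (boxCox a) fun u => balancedCoeff b a * |u| ^ (b + a + 1) := by
    refine HasCross.of_boxCox_nhdsNE
      (V := fun β u => balancedCoeff β a * |u| ^ (β + a + 1)) hb hb2 (sqIntegrableIncr_boxCox ha ha2)
      ?_ (continuousAt_balancedCoeff_mul_rpow hb ha hb2 ha2)
    filter_upwards [mem b hb hb2, eventually_nhdsNE_ne b 0] with β h1 h2
    refine (step β h1.1 h1.2 h2).swap.congr fun u => ?_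
    rw [abs_neg, balancedCoeff_comm, add_comm a β]
  refine hswap.swap.congr fun u => ?_
  rw [abs_neg, balancedCoeff_comm, add_comm a b]

end Balanced

section Causal

variable {a b : ℝ}

/-- The function `-crossPow a b` up to a linear term, continuously extended to `a + b = 0`. -/
noncomputable def causalCross (a b u : ℝ) : ℝ :=
  Real.Gamma (a + 1) * Real.Gamma (b + 1) / (2 * Real.Gamma (a + b + 2)) *
    (Real.cos (Real.pi * (b - a) / 2) / Real.sin (Real.pi * (a + b + 1) / 2) *
      |u| ^ (a + b + 1) -
      Real.sin (Real.pi * (b - a) / 2) / sinRatio (a + b) * (u * boxCox (a + b) u))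

/-- The added linear term comes from the `-1` in `boxCox`. Writing the sines of `π a` and `π b`
through half sum and half difference separates the part even in `u` from the odd part carrying the
pole. -/
lemma causalCross_eq (h1 : -1 < a + b) (h2 : a + b < 1) (h0 : a + b ≠ 0) (u : ℝ) :
    causalCross a b u = -crossPow a b u +
      Real.Gamma (a + 1) * Real.Gamma (b + 1) / (2 * Real.Gamma (a + b + 2)) *
        (Real.sin (Real.pi * (b - a) / 2) / Real.sin (Real.pi * (a + b) / 2)) * u := by
  have hc := (cos_half_pi_mul_pos h1 h2).ne'
  have hs := sin_half_pi_mul_ne_zero h1 h2 h0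
  have hG := (Real.Gamma_pos_of_pos (show 0 < a + b + 2 by linarith)).ne'
  have hS := (sinRatio_pos h1 h2).ne'
  have hSm := sinRatio_mul (a + b)
  have e1 : Real.sin (Real.pi * a) = Real.sin (Real.pi * (a + b) / 2) *
      Real.cos (Real.pi * (b - a) / 2) - Real.cos (Real.pi * (a + b) / 2) *
      Real.sin (Real.pi * (b - a) / 2) := by
    rw [← Real.sin_sub]
    ring_nf
  have e2 : Real.sin (Real.pi * b) = Real.sin (Real.pi * (a + b) / 2) *
      Real.cos (Real.pi * (b - a) / 2) + Real.cos (Real.pi * (a + b) / 2) *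
      Real.sin (Real.pi * (b - a) / 2) := by
    rw [← Real.sin_add]
    ring_nf
  rcases eq_or_ne u 0 with rfl | hu
  · rw [crossPow_zero]
    simp [causalCross, Real.zero_rpow (show a + b + 1 ≠ 0 by linarith)]
  have hB : boxCox (a + b) u = (|u| ^ (a + b) - 1) / (a + b) := by
    rw [boxCox, if_neg h0, posPow_add_posPow_neg hu]
  have hS' : sinRatio (a + b) = Real.sin (Real.pi * (a + b) / 2) / (a + b) := by
    rw [← hSm, mul_div_cancel_right₀ _ h0]
  rw [causalCross, hB, hS', crossPow, crossCoeff, crossCoeff, add_comm b a, e1, e2,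
    sin_half_pi_mul_add_one, sin_pi_mul_add_one]
  generalize Real.sin (Real.pi * (a + b) / 2) = s3 at *
  generalize Real.cos (Real.pi * (a + b) / 2) = c3 at *
  generalize Real.sin (Real.pi * (b - a) / 2) = s4 at *
  generalize Real.cos (Real.pi * (b - a) / 2) = c4 at *
  rcases lt_or_gt_of_ne hu with hu' | hu'
  · rw [posPow_of_nonpos hu'.le, posPow_of_pos (neg_pos.2 hu'), abs_of_neg hu',
      Real.rpow_add_one (by linarith)]
    field_simp
    ring
  · rw [posPow_of_nonpos (show -u ≤ 0 by linarith), posPow_of_pos hu', abs_of_pos hu',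
      Real.rpow_add_one (by linarith)]
    field_simp
    ring

lemma continuousAt_causalCross (ha : -(1 / 2) < a) (hb : -(1 / 2) < b)
    (ha2 : a < 1 / 2) (hb2 : b < 1 / 2) (u : ℝ) :
    ContinuousAt (fun α => causalCross α b u) a := by
  have g1 : ContinuousAt (fun α => Real.Gamma (α + 1)) a :=
    ContinuousAt.comp (f := fun α => α + 1) (continuousAt_Gamma_of_pos (by linarith)) (by fun_prop)
  have g2 : ContinuousAt (fun α => Real.Gamma (α + b + 2)) a :=
    ContinuousAt.comp (f := fun α => α + b + 2) (continuousAt_Gamma_of_pos (by linarith)) (by fun_prop)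
  have hs : ContinuousAt (fun α => sinRatio (α + b)) a :=
    (continuous_sinRatio.comp (continuous_add_const b)).continuousAt
  have hr : ContinuousAt (fun α => |u| ^ (α + b + 1)) a :=
    continuousAt_const.rpow (by fun_prop) (Or.inr (by linarith))
  have hB : ContinuousAt (fun α => u * boxCox (α + b) u) a := by
    rcases eq_or_ne u 0 with rfl | hu
    · simp only [zero_mul]
      exact continuousAt_const
    · exact continuousAt_const.mul (ContinuousAt.comp (f := fun α => α + b)
        (g := fun β => boxCox β u) (continuousAt_boxCox _ hu) (by fun_prop))
  have hG2 := (Real.Gamma_pos_of_pos (show 0 < a + b + 2 by linarith)).ne'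
  have hS := (sinRatio_pos (α := a + b) (by linarith) (by linarith)).ne'
  have hc := (cos_half_pi_mul_pos (x := a + b) (by linarith) (by linarith)).ne'
  rw [← sin_half_pi_mul_add_one] at hc
  unfold causalCross
  fun_prop (disch := positivity)

/-- If both points are positive, the increment is its exponent times that of `boxCox`, and `p⁻¹`
compensates the factor `p`. If only one is, the bound for a single power applies, and `p⁻¹ ≥ 1`. -/
lemma abs_kernelIncr_posPow_le {α p : ℝ} (hp : 0 < p) (hp1 : p ≤ 1) (hα : |α| ≤ p) (s t x : ℝ) :
    |kernelIncr (fun y => posPow y α) s t x| ≤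
      p⁻¹ * (|kernelIncr (fun y => posPow y p) s t x| +
        |kernelIncr (fun y => posPow y (-p)) s t x|) := by
  have hp' : 1 ≤ p⁻¹ := (one_le_inv₀ hp).2 hp1
  have single : ∀ y : ℝ, 0 < y → |posPow y α| ≤ p⁻¹ * (|posPow y p| + |posPow y (-p)|) := by
    intro y hy
    rw [abs_of_nonneg (posPow_nonneg _ _), abs_of_nonneg (posPow_nonneg _ _),
      abs_of_nonneg (posPow_nonneg _ _)]
    have h1 := rpow_le_rpow_add_rpow_neg hα hy
    rw [posPow_of_pos hy, posPow_of_pos hy, posPow_of_pos hy]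
    exact h1.trans (le_mul_of_one_le_left (by positivity) hp')
  unfold kernelIncr
  rcases le_or_gt (s - x) 0 with h1 | h1 <;> rcases le_or_gt (t - x) 0 with h2 | h2
  · simp [posPow_of_nonpos h1, posPow_of_nonpos h2]
  · simp only [posPow_of_nonpos h1, zero_sub, abs_neg]
    exact single _ h2
  · simp only [posPow_of_nonpos h2, sub_zero]
    exact single _ h1
  · have e : ∀ γ : ℝ, posPow (s - x) γ - posPow (t - x) γ =
        γ * (boxCox γ (s - x) - boxCox γ (t - x)) := by
      intro γ
      rcases eq_or_ne γ 0 with rfl | hγ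
      · simp [posPow_of_pos h1, posPow_of_pos h2]
      · rw [boxCox_of_ne_zero hγ, boxCox_of_ne_zero hγ, posPow_add_posPow_neg h1.ne',
          posPow_add_posPow_neg h2.ne', posPow_of_pos h1, posPow_of_pos h2, abs_of_pos h1,
          abs_of_pos h2]
        field_simp
        ring
    rw [e, e, e, abs_mul, abs_mul, abs_mul, abs_neg, abs_of_pos hp, ← mul_add,
      inv_mul_cancel_left₀ hp.ne']
    have := abs_boxCox_sub_boxCox_le hα h1.ne' h2.ne'
    calc |α| * |boxCox α (s - x) - boxCox α (t - x)|
        ≤ 1 * |boxCox α (s - x) - boxCox α (t - x)| := by gcongr; linarith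
      _ ≤ _ := by rw [one_mul]; exact this

/-- Cross-covariances of two causal power kernels. -/
theorem hasCross_posPow (ha : -(1 / 2) < a) (ha2 : a < 1 / 2) (hb : -(1 / 2) < b)
    (hb2 : b < 1 / 2) :
    HasCross (fun y => posPow y a) (fun y => posPow y b) (causalCross a b) := by
  obtain ⟨p, hp1, hp2⟩ := exists_between (abs_lt.2 ⟨ha, ha2⟩)
  have hp0 : 0 < p := (abs_nonneg a).trans_lt hp1
  refine HasCross.of_tendsto (l := 𝓝[≠] a) (G := fun α y => posPow y α)
    (W := fun α u => causalCross α b u) (sqIntegrableIncr_posPow hb hb2) ?_ measurable_posPow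
    (fun s t => ?_) ?_
    fun u => (continuousAt_causalCross ha hb ha2 hb2 u).tendsto.mono_left nhdsWithin_le_nhds
  · filter_upwards [mem_nhdsWithin_of_mem_nhds (Ioo_mem_nhds ha ha2),
      eventually_nhdsNE_ne a (-b)] with α h1 h3
    have h0 : α + b ≠ 0 := fun h => h3 (by linarith)
    have h4 := h1.1
    have h5 := h1.2
    -- The linear term is chosen depending on `α` so that the covariance functions converge even
    -- when the limit has `a + b = 0`.
    exact ((hasCross_posPow_posPow h1.1 h1.2 hb hb2 h0).add_linear _).congr fun u =>
      (causalCross_eq (by linarith) (by linarith) h0 u).symm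
  · refine ⟨_, (((sqIntegrableIncr_posPow (α := p) (by linarith) hp2 s t).abs).add
      ((sqIntegrableIncr_posPow (α := -p) (by linarith) (by linarith) s t).abs)).const_mul p⁻¹, ?_⟩
    filter_upwards [eventually_abs_le hp1] with α hα
    exact ae_of_all _ (abs_kernelIncr_posPow_le hp0 (by linarith) hα s t)
  · refine ae_of_all _ fun y => Tendsto.mono_left ?_ nhdsWithin_le_nhds
    rcases lt_or_ge 0 y with hy | hy
    · simp only [posPow_of_pos hy]
      exact (Real.continuous_const_rpow hy.ne').continuousAt
    · simp only [posPow_of_nonpos hy]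
      exact tendsto_const_nhds

end Causal

/-! ### The kernels as increments of moving averages -/

/-- The function `g` for which the kernel is a multiple of `s ↦ g (t - s) - g (-s)`. -/
noncomputable def baseKernel (model : Model) (H : ℝ) : ℝ → ℝ :=
  match model with
  | .causal => fun y => posPow y (H - 1 / 2)
  | .wellBalanced => boxCox (H - 1 / 2)

/-- The factor between the kernel and the increment of `baseKernel`. -/
noncomputable def kernelScale (model : Model) (H : ℝ) : ℝ :=
  match model with
  | .causal => 1
  | .wellBalanced => if H = 1 / 2 then 1 else H - 1 / 2

lemma kernel_eq (model : Model) (H t s : ℝ) :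
    kernel model H t s = kernelScale model H * kernelIncr (baseKernel model H) t 0 s := by
  cases model with
  | causal => simp [kernel, kernelScale, kernelIncr, baseKernel, fPlus]
  | wellBalanced =>
    by_cases h : H = 1 / 2
    · simp [kernel, kernelScale, kernelIncr, baseKernel, h, boxCox]
    · have h' : H - 1 / 2 ≠ 0 := sub_ne_zero.2 h
      simp only [kernel, kernelScale, kernelIncr, baseKernel, if_neg h, boxCox_of_ne_zero h', fPlus,
        fMinus, zero_sub]
      generalize H - 1 / 2 = β at *
      field_simp
      ring

/-- The function whose second differences are the cross-covariances of the base kernels. -/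
noncomputable def crossFunction (model : Model) (H₁ H₂ : ℝ) : ℝ → ℝ :=
  match model with
  | .causal => causalCross (H₁ - 1 / 2) (H₂ - 1 / 2)
  | .wellBalanced => fun u => balancedCoeff (H₁ - 1 / 2) (H₂ - 1 / 2) * |u| ^ (H₁ + H₂)

section Kernel

variable {H₁ H₂ : ℝ}

lemma hasCross_baseKernel (model : Model) (h1 : 0 < H₁ ∧ H₁ < 1) (h2 : 0 < H₂ ∧ H₂ < 1) :
    HasCross (baseKernel model H₁) (baseKernel model H₂) (crossFunction model H₁ H₂) := by
  obtain ⟨h1, h1'⟩ := h1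
  obtain ⟨h2, h2'⟩ := h2
  cases model with
  | causal => exact hasCross_posPow (by linarith) (by linarith) (by linarith) (by linarith)
  | wellBalanced =>
    refine (hasCross_boxCox (a := H₁ - 1 / 2) (b := H₂ - 1 / 2) (by linarith) (by linarith)
      (by linarith) (by linarith)).congr fun u => ?_
    rw [show H₁ - 1 / 2 + (H₂ - 1 / 2) + 1 = H₁ + H₂ by ring, crossFunction]

lemma sqIntegrableIncr_baseKernel (model : Model) (h1 : 0 < H₁ ∧ H₁ < 1) :
    SqIntegrableIncr (baseKernel model H₁) := by
  obtain ⟨h1, h1'⟩ := h1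
  cases model with
  | causal => exact sqIntegrableIncr_posPow (by linarith) (by linarith)
  | wellBalanced => exact sqIntegrableIncr_boxCox (by linarith) (by linarith)

lemma memLp_kernel (model : Model) (h1 : 0 < H₁ ∧ H₁ < 1) (t : ℝ) :
    MemLp (kernel model H₁ t) 2 volume := by
  rw [funext (kernel_eq model H₁ t)]
  exact (sqIntegrableIncr_baseKernel model h1 t 0).const_mul _

lemma integral_kernel_mul_kernel (model : Model) (h1 : 0 < H₁ ∧ H₁ < 1) (h2 : 0 < H₂ ∧ H₂ < 1)
    (t s : ℝ) : ∫ x, kernel model H₁ t x * kernel model H₂ s x =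
      kernelScale model H₁ * kernelScale model H₂ *
        (crossFunction model H₁ H₂ t + crossFunction model H₁ H₂ (-s) -
          crossFunction model H₁ H₂ (t - s) - crossFunction model H₁ H₂ 0) := by
  have := hasCross_baseKernel model h1 h2 t 0 s 0
  rw [sub_zero, zero_sub, sub_zero] at this
  rw [← this, ← integral_const_mul]
  congr 1 with x
  rw [kernel_eq, kernel_eq]
  ring

end Kernel

/-! ### Covariance of the process -/

section Covariance

variable {Ω : Type*} [MeasurableSpace Ω] {P : Measure Ω} [IsProbabilityMeasure P]
  {model : Model} {H σ : Fin 2 → ℝ} {ρ : ℝ} {W : Fin 2 → ℝ → Ω → ℝ}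

lemma matrixKernel_apply (t s : ℝ) (j m : Fin 2) : matrixKernel model H σ ρ t s j m =
    σ j * normConst model (H j) * noiseMatrix ρ j m * kernel model (H j) t s := by
  rw [matrixKernel, Matrix.diagonal_mul]
  ring

lemma memLp_matrixKernel (hH : ∀ j, 0 < H j ∧ H j < 1) (t : ℝ) (j m : Fin 2) :
    MemLp (fun s => matrixKernel model H σ ρ t s j m) 2 volume := by
  simp_rw [matrixKernel_apply]
  exact (memLp_kernel model (hH j) t).const_mul _

lemma memLp_process (hH : ∀ j, 0 < H j ∧ H j < 1) (hW : ∀ m, IsTwoSidedBrownian (W m) P)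
    (t : ℝ) (j : Fin 2) : MemLp (fun ω => process P W model H σ ρ t ω j) 2 P := by
  unfold process
  exact memLp_finsetSum _ fun m _ =>
    (isWienerIntegral_wienerIntegral (hW m) (memLp_matrixKernel hH t j m)).1

/-- The matrix is a square root of the correlation matrix; `|ρ| ≤ 1` makes the radicand nonnegative.
-/
lemma noiseMatrix_mul_transpose (hρ : |ρ| ≤ 1) (j k : Fin 2) :
    ∑ m, noiseMatrix ρ j m * noiseMatrix ρ k m = if j = k then 1 else ρ := by
  have : 0 ≤ 1 - ρ ^ 2 := by
    rw [sub_nonneg, sq_le_one_iff_abs_le_one]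
    exact hρ
  fin_cases j <;> fin_cases k <;> simp [noiseMatrix, Real.mul_self_sqrt this]; ring

lemma integral_process_mul_process (hH : ∀ j, 0 < H j ∧ H j < 1) (hρ : |ρ| ≤ 1)
    (hW : ∀ m, IsTwoSidedBrownian (W m) P)
    (hindep : IndepFun (fun ω (x : ℝ) => W 0 x ω) (fun ω (x : ℝ) => W 1 x ω) P)
    (t s : ℝ) (j k : Fin 2) :
    ∫ ω, process P W model H σ ρ t ω j * process P W model H σ ρ s ω k ∂P =
      σ j * σ k * ((if j = k then 1 else ρ) * (normConst model (H j) * normConst model (H k) *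
        ∫ x, kernel model (H j) t x * kernel model (H k) s x)) := by
  have hI := fun t j m =>
    isWienerIntegral_wienerIntegral (hW m) (memLp_matrixKernel (model := model) (σ := σ) (ρ := ρ)
      hH t j m)
  have cross : ∀ m n, m ≠ n → ∫ ω, wienerIntegral P (W m)
      (fun x => matrixKernel model H σ ρ t x j m) ω * wienerIntegral P (W n)
      (fun x => matrixKernel model H σ ρ s x k n) ω ∂P = 0 := by
    intro m n hmn
    refine IsWienerIntegral.integral_mul_of_indepFun (hW m) (hW n) ?_ (hI t j m) (hI s k n)
    fin_cases m <;> fin_cases n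
    · exact absurd rfl hmn
    · exact hindep
    · exact hindep.symm
    · exact absurd rfl hmn
  have diag : ∀ m, ∫ ω, wienerIntegral P (W m)
      (fun x => matrixKernel model H σ ρ t x j m) ω * wienerIntegral P (W m)
      (fun x => matrixKernel model H σ ρ s x k m) ω ∂P =
      noiseMatrix ρ j m * noiseMatrix ρ k m * (σ j * σ k * (normConst model (H j) *
        normConst model (H k) * ∫ x, kernel model (H j) t x * kernel model (H k) s x)) := by
    intro m
    rw [IsWienerIntegral.integral_mul (hW m) (memLp_matrixKernel hH t j m)
      (memLp_matrixKernel hH s k m) (hI t j m) (hI s k m)]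
    simp_rw [matrixKernel_apply]
    rw [← integral_const_mul, ← integral_const_mul, ← integral_const_mul]
    congr 1 with x
    ring
  have hint : ∀ m n, Integrable (fun ω => wienerIntegral P (W m)
      (fun x => matrixKernel model H σ ρ t x j m) ω * wienerIntegral P (W n)
      (fun x => matrixKernel model H σ ρ s x k n) ω) P := fun m n =>
    integrable_mul_of_memLp_two (hI t j m).1 (hI s k n).1
  simp only [process, Finset.sum_mul_sum]
  rw [integral_finsetSum _ fun m _ => integrable_finsetSum _ fun n _ => hint m n]
  have inner : ∀ m, ∫ ω, ∑ n, wienerIntegral P (W m)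
      (fun x => matrixKernel model H σ ρ t x j m) ω * wienerIntegral P (W n)
      (fun x => matrixKernel model H σ ρ s x k n) ω ∂P =
      noiseMatrix ρ j m * noiseMatrix ρ k m * (σ j * σ k * (normConst model (H j) *
        normConst model (H k) * ∫ x, kernel model (H j) t x * kernel model (H k) s x)) := by
    intro m
    rw [integral_finsetSum _ fun n _ => hint m n, Finset.sum_eq_single m
      (fun n _ hn => cross m n hn.symm) (by simp), diag]
  simp_rw [inner]
  rw [← Finset.sum_mul, noiseMatrix_mul_transpose hρ]
  ring

/-- The covariance of the increments is the second difference of a single function. -/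
lemma integral_increment_mul_increment (hH : ∀ j, 0 < H j ∧ H j < 1) (hρ : |ρ| ≤ 1)
    (hW : ∀ m, IsTwoSidedBrownian (W m) P)
    (hindep : IndepFun (fun ω (x : ℝ) => W 0 x ω) (fun ω (x : ℝ) => W 1 x ω) P)
    (δ t s : ℝ) (j k : Fin 2) :
    ∫ ω, increment (process P W model H σ ρ) δ t ω j * increment (process P W model H σ ρ) δ s ω k
      ∂P = σ j * σ k * ((if j = k then 1 else ρ) *
        (normConst model (H j) * kernelScale model (H j) *
          (normConst model (H k) * kernelScale model (H k))) *
        (crossFunction model (H j) (H k) (t - s + δ) + crossFunction model (H j) (H k) (t - s - δ) -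
          2 * crossFunction model (H j) (H k) (t - s))) := by
  have hL := fun t j => memLp_process (model := model) (σ := σ) (ρ := ρ) hH hW t j
  have hi : ∀ t s, Integrable (fun ω => process P W model H σ ρ t ω j *
      process P W model H σ ρ s ω k) P := fun t s =>
    integrable_mul_of_memLp_two (hL t j) (hL s k)
  have hs : ∀ t p q, Integrable (fun ω => process P W model H σ ρ t ω j *
      process P W model H σ ρ p ω k - process P W model H σ ρ t ω j *
      process P W model H σ ρ q ω k) P := fun t p q => (hi t p).sub (hi t q)
  have e : ∀ ω, increment (process P W model H σ ρ) δ t ω j *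
      increment (process P W model H σ ρ) δ s ω k =
      (process P W model H σ ρ (t + δ) ω j * process P W model H σ ρ (s + δ) ω k -
        process P W model H σ ρ (t + δ) ω j * process P W model H σ ρ s ω k) -
      (process P W model H σ ρ t ω j * process P W model H σ ρ (s + δ) ω k -
        process P W model H σ ρ t ω j * process P W model H σ ρ s ω k) := fun ω => by
    simp only [increment, Pi.sub_apply]
    ring
  simp_rw [e]
  rw [integral_sub (hs _ _ _) (hs _ _ _), integral_sub (hi _ _) (hi _ _),
    integral_sub (hi _ _) (hi _ _)]
  simp_rw [integral_process_mul_process hH hρ hW hindep,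
    integral_kernel_mul_kernel model (hH j) (hH k)]
  -- The values depending on `t` or `s` alone, and the value at `0`, cancel, leaving only arguments
  -- near `t - s`.
  rw [show t + δ - (s + δ) = t - s by ring, show t + δ - s = t - s + δ by ring,
    show t - (s + δ) = t - s - δ by ring]
  ring

end Covariance

/-! ### The normalizing constants -/

/-- `√(Γ(2H+1) sin(πH))`. -/
noncomputable def spectralAmplitude (H : ℝ) : ℝ :=
  √(Real.Gamma (2 * H + 1) * Real.sin (H * Real.pi))

section Constants

variable {H H₁ H₂ : ℝ}

lemma sin_mul_pi_pos (h0 : 0 < H) (h1 : H < 1) : 0 < Real.sin (H * Real.pi) :=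
  Real.sin_pos_of_pos_of_lt_pi (by positivity) (by nlinarith [Real.pi_pos])

lemma spectralAmplitude_sq (h0 : 0 < H) (h1 : H < 1) :
    spectralAmplitude H * spectralAmplitude H =
      Real.Gamma (2 * H + 1) * Real.sin (H * Real.pi) := by
  have := sin_mul_pi_pos h0 h1
  have := Real.Gamma_pos_of_pos (show 0 < 2 * H + 1 by linarith)
  exact Real.mul_self_sqrt (by positivity)

lemma spectralAmplitude_pos (h0 : 0 < H) (h1 : H < 1) : 0 < spectralAmplitude H := by
  have := sin_mul_pi_pos h0 h1
  have := Real.Gamma_pos_of_pos (show 0 < 2 * H + 1 by linarith)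
  exact Real.sqrt_pos.2 (by positivity)

lemma amplitude_eq {H : Fin 2 → ℝ} (hH : ∀ j, 0 < H j ∧ H j < 1) :
    amplitude H = spectralAmplitude (H 0) * spectralAmplitude (H 1) := by
  have := sin_mul_pi_pos (hH 0).1 (hH 0).2
  have := Real.Gamma_pos_of_pos (show 0 < 2 * H 0 + 1 by linarith [(hH 0).1])
  rw [amplitude, spectralAmplitude, spectralAmplitude, ← Real.sqrt_mul (by positivity)]
  congr 1
  ring

/-- The left side is the variance of a unit increment with base kernel `boxCox`; as a perfect square
it makes the normalizing root explicit. -/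
lemma balancedCoeff_self (h0 : 0 < H) (h1 : H < 1) :
    2 * balancedCoeff (H - 1 / 2) (H - 1 / 2) =
      (2 * Real.Gamma (H + 1 / 2) * sinRatio (H - 1 / 2) / spectralAmplitude H) ^ 2 := by
  have := spectralAmplitude_pos h0 h1
  rw [div_pow, pow_two (spectralAmplitude H), spectralAmplitude_sq h0 h1, balancedCoeff,
    show H - 1 / 2 + 1 = H + 1 / 2 by ring,
    show H - 1 / 2 + (H - 1 / 2) + 2 = 2 * H + 1 by ring,
    show Real.pi * (H - 1 / 2 + (H - 1 / 2) + 1) / 2 = H * Real.pi by ring]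
  ring

lemma normConst_causal_mul_kernelScale : normConst .causal H * kernelScale .causal H =
    spectralAmplitude H / Real.Gamma (H + 1 / 2) := by
  simp [normConst, kernelScale, spectralAmplitude]

/-- The normalizing integral contains the square of the scale, so its root contains the absolute
value. The quotient of scale and absolute value is the origin of `balanceSign`. -/
lemma normConst_wellBalanced_mul_kernelScale (h0 : 0 < H) (h1 : H < 1) :
    normConst .wellBalanced H * kernelScale .wellBalanced H =
      balanceSign H * (spectralAmplitude H /
        (2 * Real.Gamma (H + 1 / 2) * sinRatio (H - 1 / 2))) := by
  have hA := spectralAmplitude_pos h0 h1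
  have hG := Real.Gamma_pos_of_pos (show 0 < H + 1 / 2 by linarith)
  have hS := sinRatio_pos (α := H - 1 / 2) (by linarith) (by linarith)
  have hsq : ∫ x, kernel .wellBalanced H 1 x ^ 2 = (kernelScale .wellBalanced H *
      (2 * Real.Gamma (H + 1 / 2) * sinRatio (H - 1 / 2) / spectralAmplitude H)) ^ 2 := by
    simp_rw [pow_two (kernel _ _ _ _)]
    rw [integral_kernel_mul_kernel .wellBalanced ⟨h0, h1⟩ ⟨h0, h1⟩, mul_pow,
      ← balancedCoeff_self h0 h1]
    simp [crossFunction, Real.zero_rpow (show H + H ≠ 0 by linarith)]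
    ring
  have hscale : kernelScale .wellBalanced H = balanceSign H * |kernelScale .wellBalanced H| ∧
      kernelScale .wellBalanced H ≠ 0 := by
    unfold kernelScale balanceSign
    rcases lt_trichotomy H (1 / 2) with h | h | h
    · simp only [if_neg h.ne, if_pos h]
      rw [abs_of_neg (by linarith)]
      exact ⟨by ring, by linarith⟩
    · simp [h]
    · simp only [if_neg h.ne', if_neg h.not_gt]
      rw [abs_of_pos (by linarith)]
      exact ⟨by ring, by linarith⟩
  have habs := abs_pos.2 hscale.2
  rw [normConst, hsq, Real.sqrt_sq_eq_abs, abs_mul, abs_of_pos (a := _ / _) (by positivity)]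
  nth_rewrite 2 [hscale.1]
  field_simp

end Constants

/-! ### Identification of the covariance function -/

section Identification

variable {H₁ H₂ : ℝ}

lemma sign_mul_abs (u : ℝ) : Real.sign u * |u| = u := by
  rcases lt_trichotomy u 0 with h | rfl | h
  · rw [Real.sign_of_neg h, abs_of_neg h]
    ring
  · simp
  · rw [Real.sign_of_pos h, abs_of_pos h, one_mul]

/-- Since `u = sign u * |u|`, the odd part becomes a signed power, with a logarithm exactly when `H₁
+ H₂ = 1`; the constant inside `boxCox` leaves the linear term. -/
lemma causalCross_eq_sign (h1 : 0 < H₁ ∧ H₁ < 1) (h2 : 0 < H₂ ∧ H₂ < 1) :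
    ∃ m, ∀ u, causalCross (H₁ - 1 / 2) (H₂ - 1 / 2) u =
      Real.Gamma (H₁ + 1 / 2) * Real.Gamma (H₂ + 1 / 2) / (2 * Real.Gamma (H₁ + H₂ + 1)) *
        ((Real.cos ((H₂ - H₁) * Real.pi / 2) / Real.sin ((H₁ + H₂) / 2 * Real.pi) -
          if H₁ + H₂ = 1 then
            2 / Real.pi * Real.sin ((H₂ - H₁) * Real.pi / 2) * Real.sign u * Real.log |u|
          else -(Real.sin ((H₂ - H₁) * Real.pi / 2) / Real.cos ((H₁ + H₂) / 2 * Real.pi)) *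
            Real.sign u) * |u| ^ (H₁ + H₂)) + m * u := by
  obtain ⟨h1, h1'⟩ := h1
  obtain ⟨h2, h2'⟩ := h2
  have hsum : H₁ - 1 / 2 + (H₂ - 1 / 2) = H₁ + H₂ - 1 := by ring
  have expand : ∀ u, causalCross (H₁ - 1 / 2) (H₂ - 1 / 2) u =
      Real.Gamma (H₁ + 1 / 2) * Real.Gamma (H₂ + 1 / 2) / (2 * Real.Gamma (H₁ + H₂ + 1)) *
        (Real.cos ((H₂ - H₁) * Real.pi / 2) / Real.sin ((H₁ + H₂) / 2 * Real.pi) *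
          |u| ^ (H₁ + H₂) - Real.sin ((H₂ - H₁) * Real.pi / 2) / sinRatio (H₁ + H₂ - 1) *
          (u * boxCox (H₁ + H₂ - 1) u)) := by
    intro u
    rw [causalCross, hsum, show H₁ - 1 / 2 + 1 = H₁ + 1 / 2 by ring,
      show H₂ - 1 / 2 + 1 = H₂ + 1 / 2 by ring, show H₁ + H₂ - 1 + 2 = H₁ + H₂ + 1 by ring,
      sub_add_cancel, show Real.pi * (H₂ - 1 / 2 - (H₁ - 1 / 2)) / 2 = (H₂ - H₁) * Real.pi / 2 by
      ring, show Real.pi * (H₁ + H₂) / 2 = (H₁ + H₂) / 2 * Real.pi by ring]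
  by_cases h : H₁ + H₂ = 1
  · refine ⟨0, fun u => ?_⟩
    have hB : boxCox 0 u = Real.log |u| := if_pos rfl
    have hS : sinRatio 0 = Real.pi / 2 := by simp [sinRatio]
    rw [expand, if_pos h, h, sub_self, hB, hS, Real.rpow_one]
    nth_rewrite 2 [← sign_mul_abs u]
    have := Real.pi_pos.ne'
    field_simp
    ring
  · have h0 : H₁ + H₂ - 1 ≠ 0 := sub_ne_zero.2 h
    have hs := sinRatio_mul (H₁ + H₂ - 1)
    have hc : Real.sin (Real.pi * (H₁ + H₂ - 1) / 2) = -Real.cos ((H₁ + H₂) / 2 * Real.pi) := by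
      rw [show Real.pi * (H₁ + H₂ - 1) / 2 = (H₁ + H₂) / 2 * Real.pi - Real.pi / 2 by ring,
        Real.sin_sub_pi_div_two]
    have hne := sin_half_pi_mul_ne_zero (x := H₁ + H₂ - 1) (by linarith) (by linarith) h0
    rw [hc] at hs hne
    have hne' : Real.cos ((H₁ + H₂) / 2 * Real.pi) ≠ 0 := by simpa using hne
    have hS : sinRatio (H₁ + H₂ - 1) =
        -(Real.cos ((H₁ + H₂) / 2 * Real.pi) / (H₁ + H₂ - 1)) := by
      rw [← neg_div, ← hs, mul_div_cancel_right₀ _ h0]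
    refine ⟨-(Real.Gamma (H₁ + 1 / 2) * Real.Gamma (H₂ + 1 / 2) /
      (2 * Real.Gamma (H₁ + H₂ + 1)) *
      (Real.sin ((H₂ - H₁) * Real.pi / 2) / Real.cos ((H₁ + H₂) / 2 * Real.pi))), fun u => ?_⟩
    have hB : u * boxCox (H₁ + H₂ - 1) u =
        (Real.sign u * |u| ^ (H₁ + H₂) - u) / (H₁ + H₂ - 1) := by
      rcases eq_or_ne u 0 with rfl | hu
      · simp
      · rw [boxCox, if_neg h0, posPow_add_posPow_neg hu]
        have : |u| ^ (H₁ + H₂) = |u| ^ (H₁ + H₂ - 1) * |u| := by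
          rw [← Real.rpow_add_one (abs_ne_zero.2 hu), sub_add_cancel]
        rw [this, mul_left_comm, sign_mul_abs]
        ring
    rw [expand, if_neg h, hS, hB]
    generalize Real.cos ((H₁ + H₂) / 2 * Real.pi) = c at *
    field_simp
    ring

end Identification

lemma w_self (model : Model) (H : Fin 2 → ℝ) (ρ : ℝ) (j : Fin 2) (u : ℝ) :
    w model H ρ j j u = 1 := by
  have h : etaCoeff model H ρ j j = 0 := by fin_cases j <;> simp [etaCoeff]
  simp [w, rhoCoeff, h]

/-! ### Matching the normalized covariance function with `w` -/

section Pair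

variable {H : Fin 2 → ℝ}

lemma causal_crossFunction_eq (hH : ∀ j, 0 < H j ∧ H j < 1) (ρ : ℝ) (j k : Fin 2) :
    ∃ m, ∀ u, (if j = k then 1 else ρ) *
      (normConst .causal (H j) * kernelScale .causal (H j) *
        (normConst .causal (H k) * kernelScale .causal (H k))) *
          crossFunction .causal (H j) (H k) u =
      w .causal H ρ j k u * |u| ^ (H j + H k) / 2 + m * u := by
  obtain ⟨m, hm⟩ := causalCross_eq_sign (hH j) (hH k)
  refine ⟨(if j = k then 1 else ρ) * (normConst .causal (H j) * kernelScale .causal (H j) *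
    (normConst .causal (H k) * kernelScale .causal (H k))) * m, fun u => ?_⟩
  have hG : ∀ j, Real.Gamma (H j + 1 / 2) ≠ 0 := fun j =>
    (Real.Gamma_pos_of_pos (by linarith [(hH j).1])).ne'
  have hG2 : Real.Gamma (H j + H k + 1) ≠ 0 :=
    (Real.Gamma_pos_of_pos (by linarith [(hH j).1, (hH k).1])).ne'
  have hS : Real.sin ((H j + H k) / 2 * Real.pi) ≠ 0 :=
    (sin_mul_pi_pos (by linarith [(hH j).1, (hH k).1]) (by linarith [(hH j).2, (hH k).2])).ne'
  have hGj := hG j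
  have hGk := hG k
  rw [normConst_causal_mul_kernelScale, normConst_causal_mul_kernelScale, crossFunction, hm,
    mul_add, mul_assoc _ m u]
  congr 1
  have hA : ∀ x : ℝ, spectralAmplitude (H j) / Real.Gamma (H j + 1 / 2) *
      (spectralAmplitude (H k) / Real.Gamma (H k + 1 / 2)) *
      (Real.Gamma (H j + 1 / 2) * Real.Gamma (H k + 1 / 2) / (2 * Real.Gamma (H j + H k + 1)) * x) =
      spectralAmplitude (H j) * spectralAmplitude (H k) / Real.Gamma (H j + H k + 1) * x / 2 := by
    intro x
    generalize Real.Gamma (H j + 1 / 2) = g1 at *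
    generalize Real.Gamma (H k + 1 / 2) = g2 at *
    field_simp
  rw [mul_assoc, hA]
  rcases eq_or_ne j k with rfl | hjk
  · rw [if_pos rfl, w_self, spectralAmplitude_sq (hH j).1 (hH j).2,
      show (H j + H j) / 2 = H j by ring]
    rw [show (H j + H j) / 2 = H j by ring] at hS
    rw [show H j + H j + 1 = 2 * H j + 1 by ring] at hG2 ⊢
    simp only [sub_self, zero_mul, zero_div, Real.cos_zero, Real.sin_zero, mul_zero, neg_zero,
      ite_self, sub_zero]
    field_simp
  · rw [if_neg hjk, w, rhoCoeff, if_neg hjk]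
    have key : ∀ x : ℝ, Real.sin (x / 2) = -Real.sin (-x / 2) := fun x => by
      rw [neg_div, Real.sin_neg, neg_neg]
    have key' : ∀ x : ℝ, Real.cos (x / 2) = Real.cos (-x / 2) := fun x => by
      rw [neg_div, Real.cos_neg]
    have hΓ : H 0 + H 1 = 1 → Real.Gamma (H 0 + H 1 + 1) = 1 := fun h => by
      rw [h, one_add_one_eq_two, Real.Gamma_two]
    fin_cases j <;> fin_cases k
    · exact absurd rfl hjk
    · simp only [Fin.zero_eta, Fin.mk_one, etaCoeff, etaOneTwo, amplitude_eq hH,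
        Matrix.of_apply, Matrix.cons_val', Matrix.cons_val_zero, Matrix.cons_val_one,
        Matrix.cons_val_fin_one] at *
      split_ifs with h
      · rw [hΓ h]
        ring
      · ring
    · simp only [Fin.zero_eta, Fin.mk_one, etaCoeff, etaOneTwo, amplitude_eq hH,
        Matrix.of_apply, Matrix.cons_val', Matrix.cons_val_zero, Matrix.cons_val_one,
        Matrix.cons_val_fin_one] at *
      -- Exchanging the components preserves the cosine and negates the sine: this is the symmetry
      -- of `ρ_jk` and antisymmetry of `η_jk`.
      rw [key ((H 0 - H 1) * Real.pi), key' ((H 0 - H 1) * Real.pi), ← neg_mul, neg_sub,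
        add_comm (H 1) (H 0)]
      split_ifs with h
      · rw [hΓ h]
        ring
      · ring
    · exact absurd rfl hjk

lemma wellBalanced_crossFunction_eq (hH : ∀ j, 0 < H j ∧ H j < 1) (ρ : ℝ) (j k : Fin 2) (u : ℝ) :
    (if j = k then 1 else ρ) *
      (normConst .wellBalanced (H j) * kernelScale .wellBalanced (H j) *
        (normConst .wellBalanced (H k) * kernelScale .wellBalanced (H k))) *
          crossFunction .wellBalanced (H j) (H k) u =
      w .wellBalanced H ρ j k u * |u| ^ (H j + H k) / 2 := by
  have hG : ∀ j, Real.Gamma (H j + 1 / 2) ≠ 0 := fun j =>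
    (Real.Gamma_pos_of_pos (by linarith [(hH j).1])).ne'
  have hR : ∀ j, sinRatio (H j - 1 / 2) ≠ 0 := fun j =>
    (sinRatio_pos (by linarith [(hH j).1]) (by linarith [(hH j).2])).ne'
  have hG2 : Real.Gamma (H j + H k + 1) ≠ 0 :=
    (Real.Gamma_pos_of_pos (by linarith [(hH j).1, (hH k).1])).ne'
  have hS : Real.sin ((H j + H k) / 2 * Real.pi) ≠ 0 :=
    (sin_mul_pi_pos (by linarith [(hH j).1, (hH k).1]) (by linarith [(hH j).2, (hH k).2])).ne'
  have hGj := hG j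
  have hGk := hG k
  have hRj := hR j
  have hRk := hR k
  have hB : balancedCoeff (H j - 1 / 2) (H k - 1 / 2) =
      2 * Real.Gamma (H j + 1 / 2) * Real.Gamma (H k + 1 / 2) * sinRatio (H j - 1 / 2) *
        sinRatio (H k - 1 / 2) /
        (Real.Gamma (H j + H k + 1) * Real.sin ((H j + H k) / 2 * Real.pi)) := by
    rw [balancedCoeff, show H j - 1 / 2 + 1 = H j + 1 / 2 by ring,
      show H k - 1 / 2 + 1 = H k + 1 / 2 by ring,
      show H j - 1 / 2 + (H k - 1 / 2) + 2 = H j + H k + 1 by ring,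
      show Real.pi * (H j - 1 / 2 + (H k - 1 / 2) + 1) / 2 = (H j + H k) / 2 * Real.pi by ring]
  rw [normConst_wellBalanced_mul_kernelScale (hH j).1 (hH j).2,
    normConst_wellBalanced_mul_kernelScale (hH k).1 (hH k).2, crossFunction, hB]
  have e : (if j = k then 1 else ρ) * (balanceSign (H j) * (spectralAmplitude (H j) /
      (2 * Real.Gamma (H j + 1 / 2) * sinRatio (H j - 1 / 2))) *
      (balanceSign (H k) * (spectralAmplitude (H k) /
      (2 * Real.Gamma (H k + 1 / 2) * sinRatio (H k - 1 / 2))))) *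
      (2 * Real.Gamma (H j + 1 / 2) * Real.Gamma (H k + 1 / 2) * sinRatio (H j - 1 / 2) *
        sinRatio (H k - 1 / 2) /
        (Real.Gamma (H j + H k + 1) * Real.sin ((H j + H k) / 2 * Real.pi)) *
          |u| ^ (H j + H k)) =
      (if j = k then 1 else ρ) * (balanceSign (H j) * balanceSign (H k)) *
        (spectralAmplitude (H j) * spectralAmplitude (H k) /
          (Real.Gamma (H j + H k + 1) * Real.sin ((H j + H k) / 2 * Real.pi))) *
          |u| ^ (H j + H k) / 2 := by
    generalize Real.Gamma (H j + 1 / 2) = g1 at *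
    generalize Real.Gamma (H k + 1 / 2) = g2 at *
    generalize sinRatio (H j - 1 / 2) = r1 at *
    generalize sinRatio (H k - 1 / 2) = r2 at *
    field_simp
  rw [e]
  rcases eq_or_ne j k with rfl | hjk
  · have hsign : balanceSign (H j) * balanceSign (H j) = 1 := by
      unfold balanceSign
      split_ifs <;> norm_num
    rw [if_pos rfl, w_self, hsign, spectralAmplitude_sq (hH j).1 (hH j).2]
    rw [show (H j + H j) / 2 = H j by ring] at hS ⊢
    rw [show H j + H j + 1 = 2 * H j + 1 by ring] at hG2 ⊢
    rw [div_self (mul_ne_zero hG2 hS)]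
    ring
  · have hη : etaCoeff .wellBalanced H ρ j k = 0 := by
      fin_cases j <;> fin_cases k <;> simp [etaCoeff, etaOneTwo]
    have hw : w .wellBalanced H ρ j k u = rhoCoeff .wellBalanced H ρ j k := by
      simp [w, hη]
    rw [hw, rhoCoeff, if_neg hjk, if_neg hjk, amplitude_eq hH]
    fin_cases j <;> fin_cases k
    · exact absurd rfl hjk
    · simp only [Fin.zero_eta, Fin.mk_one]
      ring
    · simp only [Fin.zero_eta, Fin.mk_one]
      rw [add_comm (H 1) (H 0)]
      ring
    · exact absurd rfl hjk

lemma crossFunction_eq (hH : ∀ j, 0 < H j ∧ H j < 1) (model : Model) (ρ : ℝ)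
    (j k : Fin 2) : ∃ m, ∀ u, (if j = k then 1 else ρ) *
      (normConst model (H j) * kernelScale model (H j) *
        (normConst model (H k) * kernelScale model (H k))) * crossFunction model (H j) (H k) u =
      w model H ρ j k u * |u| ^ (H j + H k) / 2 + m * u := by
  cases model with
  | causal => exact causal_crossFunction_eq hH ρ j k
  | wellBalanced =>
    refine ⟨0, fun u => ?_⟩
    rw [wellBalanced_crossFunction_eq hH, zero_mul, add_zero]

end Pair

end FBm2D

theorem theorem2 {Ω : Type*} [MeasurableSpace Ω] (P : Measure Ω) [IsProbabilityMeasure P]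
    (model : FBm2D.Model) (H σ : Fin 2 → ℝ) (ρ : ℝ)
    (hH : ∀ j, 0 < H j ∧ H j < 1) (hσ : ∀ j, 0 < σ j) (hρ : |ρ| ≤ 1)
    (W : Fin 2 → ℝ → Ω → ℝ) (hW : ∀ m, FBm2D.IsTwoSidedBrownian (W m) P)
    (hindep : IndepFun (fun ω (x : ℝ) => W 0 x ω) (fun ω (x : ℝ) => W 1 x ω) P)
    (Z : ℝ → Ω → Fin 2 → ℝ)
    (hZ : ∀ t, 0 ≤ t → ∀ᵐ ω ∂P, Z t ω = FBm2D.process P W model H σ ρ t ω)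
    (δ : ℝ) (hδ : 0 < δ) (t s : ℝ) (ht : 0 ≤ t) (hs : 0 ≤ s) (j k : Fin 2) :
    Integrable (fun ω => FBm2D.increment Z δ t ω j * FBm2D.increment Z δ s ω k) P ∧
    ∫ ω, FBm2D.increment Z δ t ω j * FBm2D.increment Z δ s ω k ∂P =
      σ j * σ k / 2 *
        (FBm2D.w model H ρ j k (t - s + δ) * |t - s + δ| ^ (H j + H k) +
          FBm2D.w model H ρ j k (t - s - δ) * |t - s - δ| ^ (H j + H k) -
          2 * FBm2D.w model H ρ j k (t - s) * |t - s| ^ (H j + H k)) := by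
  have hae : (fun ω => FBm2D.increment Z δ t ω j * FBm2D.increment Z δ s ω k) =ᵐ[P]
      fun ω => FBm2D.increment (FBm2D.process P W model H σ ρ) δ t ω j *
        FBm2D.increment (FBm2D.process P W model H σ ρ) δ s ω k := by
    filter_upwards [hZ (t + δ) (by linarith), hZ t ht, hZ (s + δ) (by linarith), hZ s hs]
      with ω h1 h2 h3 h4
    simp only [FBm2D.increment, h1, h2, h3, h4]
  have hL := fun t j => FBm2D.memLp_process (model := model) (σ := σ) (ρ := ρ) hH hW t j
  refine ⟨Integrable.congr ?_ hae.symm, ?_⟩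
  · exact FBm2D.integrable_mul_of_memLp_two ((hL (t + δ) j).sub (hL t j))
      ((hL (s + δ) k).sub (hL s k))
  · obtain ⟨m, hm⟩ := FBm2D.crossFunction_eq hH model ρ j k
    rw [integral_congr_ae hae, FBm2D.integral_increment_mul_increment hH hρ hW hindep]
    have h1 := hm (t - s + δ)
    have h2 := hm (t - s - δ)
    have h3 := hm (t - s)
    -- The linear term `m * u` has vanishing second difference, so `m` disappears.
    linear_combination (σ j * σ k) * h1 + (σ j * σ k) * h2 - 2 * (σ j * σ k) * h3
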